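/- Let $k$ be a field and let $(\mathscr{C},\mathbb{E},\mathfrak{s})$ be an extriangulated category (in the sense of Nakaoka--Palu) whose underlying additive category is skeletally small, $k$-linear, Hom-finite and Krull--Schmidt. All subcategories are full and closed under isomorphisms. Let $\mathcal{X}$ be a semibrick in $\mathscr{C}$, that is, a set of isomorphism classes of objects whose endomorphism rings are division rings, with $\mathrm{Hom}(X_1,X_2)=0$ for non-isomorphic $X_1,X_2\in\mathcal{X}$. For a collection $\mathcal{Y}$ of objects of an extriangulated category $\mathscr{D}$, $\mathrm{Filt}_{\mathscr{D}}(\mathcal{Y})$ consists of the objects $M$ admitting a finite chain of inflations $0=Y_0\to Y_1\to\cdots\to Y_n=M$ whose cones all lie in $\mathcal{Y}$. Let $\mathcal{T}=\mathrm{Filt}_{\mathscr{C}}(\mathcal{X})$, which is closed under extensions in $\mathscr{C}$ and hence an extriangulated category with the inherited structure. For $\mathcal{S}\subseteq\mathcal{X}$ write, inside $\mathcal{T}$: $\mathcal{S}^{\perp}=\{M : \mathrm{Hom}(\mathcal{S},M)=0\}$, ${}^{\perp}\mathcal{S}=\{M : \mathrm{Hom}(M,\mathcal{S})=0\}$, $\mathcal{S}^{\perp_1}=\{M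 : \mathbb{E}(\mathcal{S},M)=0\}$, ${}^{\perp_1}\mathcal{S}=\{M : \mathbb{E}(M,\mathcal{S})=0\}$. For a subcategory $\mathcal{D}$ of $\mathcal{T}$ let $\mathcal{S}_{\mathcal{D}}$ denote the subset of $\mathcal{X}$ such that $\mathrm{Filt}_{\mathcal{T}}(\mathcal{S}_{\mathcal{D}})$ is the smallest of the subcategories $\mathrm{Filt}_{\mathcal{T}}(\mathcal{Y})$, $\mathcal{Y}\subseteq\mathcal{X}$, that contain $\mathcal{D}$. Let $\mathcal{P}$ and $\mathcal{I}$ be the subcategories of projective and of injective objects of $\mathcal{T}$. A cotorsion pair in $\mathcal{T}$ is a pair $(\mathcal{U},\mathcal{V})$ of subcategories closed under direct summands such that $\mathbb{E}(\mathcal{U},\mathcal{V})=0$ and every $M\in\mathcal{T}$ admits conflations $V\to U\to M$ and $M\to V'\to U'$ in $\mathcal{T}$ with $U,U'\in\mathcal{U}$ and $V,V'\in\mathcal{V}$. Then for every subset $\mathcal{S}\subseteq\mathcal{X}$: (1) For every $M\in\mathcal{T}$ there is an $\mathbb{E}$-triangle $N\to M\to P\dashrightarrow$ in $\mathcal{T}$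 with $N\in\mathrm{Filt}_{\mathcal{T}}(\mathcal{S})$ and $P\in\mathcal{S}^{\perp}$. (2) For every $M\in\mathcal{T}$ there is an $\mathbb{E}$-triangle $U\to M\to V\dashrightarrow$ in $\mathcal{T}$ with $U\in{}^{\perp}\mathcal{S}$ and $V\in\mathrm{Filt}_{\mathcal{T}}(\mathcal{S})$. (3) $\mathrm{Filt}_{\mathcal{T}}(\mathcal{S})$ is functorially finite in $\mathcal{T}$, i.e. both contravariantly finite (every $M\in\mathcal{T}$ admits a morphism $A\to M$ with $A$ in the subcategory through which every morphism from an object of the subcategory to $M$ factors) and, dually, covariantly finite. (4) The subsets $\mathcal{S}_{\mathcal{P}}$ and $\mathcal{S}_{\mathcal{I}}$ of $\mathcal{X}$ exist and are unique. Assume that $\mathcal{T}$ has enough projectives and enough injectives. If $\mathcal{S}_{\mathcal{P}}\subseteq\mathcal{S}$, then $(\mathrm{Filt}_{\mathcal{T}}(\mathcal{S}),\mathcal{S}^{\perp_1})$ is a cotorsion pair in $\mathcal{T}$. Dually, if $\mathcal{S}_{\mathcal{I}}\subseteq\mathcal{S}$, then $({}^{\perp_1}\mathcal{S},\mathrm{Filt}_{\mathcal{T}}(\mathcal{S}))$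 is a cotorsion pair in $\mathcal{T}$. -/

import Mathlib

open CategoryTheory CategoryTheory.Limits Opposite

universe w v u

/-- The data underlying an extriangulated category: a functor `E : Cᵒᵖ × C → Ab` and a relation
saying which sequences `A ⟶ B ⟶ Z` belong to the class `𝔰(δ)` assigned to an extension
`δ ∈ E(Z, A)`. -/
structure ExtData (C : Type u) [Category.{v} C] where
  /-- the functor `E(-, -)`, contravariant in the first variable -/
  E : Cᵒᵖ ⥤ C ⥤ AddCommGrpCat.{w}
  /-- `Realizes δ x y` means that the sequence `(x, y)` is a member of the class `𝔰(δ)`, that is,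
  `A --x--> B --y--> Z --δ-->` is an `E`-triangle -/
  Realizes : ∀ {A B Z : C} (_ : (E.obj (op Z)).obj A) (_ : A ⟶ B) (_ : B ⟶ Z), Prop

namespace ExtData

variable {C : Type u} [Category.{v} C] (𝔼 : ExtData.{w} C)

/-- The group `E(Z, A)` of extensions. -/
abbrev Ext (Z A : C) : Type w := (𝔼.E.obj (op Z)).obj A

/-- `a_* δ = E(Z, a)(δ)`. -/
def push {Z A A' : C} (a : A ⟶ A') (δ : 𝔼.Ext Z A) : 𝔼.Ext Z A' :=
  ((𝔼.E.obj (op Z)).map a).hom δ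

/-- `c^* δ = E(c, A)(δ)`. -/
def pull {Z' Z A : C} (c : Z' ⟶ Z) (δ : 𝔼.Ext Z A) : 𝔼.Ext Z' A :=
  ((𝔼.E.map c.op).app A).hom δ

/-- `A --x--> B --y--> Z` is a conflation if it realizes some extension. -/
def Conflation {A B Z : C} (x : A ⟶ B) (y : B ⟶ Z) : Prop :=
  ∃ δ : 𝔼.Ext Z A, 𝔼.Realizes δ x y

end ExtData

/-- An extriangulated structure (Nakaoka--Palu) on an additive category `C`. Direct sums are only
determined up to isomorphism, so the two conditions on an additive realization are required for
every choice of the direct sums that occur in them. -/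
structure Extriangulated (C : Type u) [Category.{v} C] [Preadditive C] [HasFiniteBiproducts C]
    extends ExtData.{w} C where
  /-- (ET1): `E` is biadditive -/
  additive_fst : E.Additive
  additive_snd : ∀ Z : Cᵒᵖ, (E.obj Z).Additive
  /-- `𝔰(δ)` is nonempty ... -/
  exists_realizes : ∀ {A Z : C} (δ : toExtData.Ext Z A),
    ∃ (B : C) (x : A ⟶ B) (y : B ⟶ Z), Realizes δ x y
  /-- ... and is precisely one equivalence class of sequences. -/
  realizes_iff : ∀ {A B B' Z : C} {δ : toExtData.Ext Z A} {x : A ⟶ B} {y : B ⟶ Z},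
    Realizes δ x y → ∀ (x' : A ⟶ B') (y' : B' ⟶ Z),
      (Realizes δ x' y' ↔ ∃ b : B ≅ B', x ≫ b.hom = x' ∧ b.hom ≫ y' = y)
  /-- (ET2): `𝔰` is a realization: morphisms of extensions lift to morphisms of sequences -/
  realize_hom : ∀ {A B Z A' B' Z' : C} {δ : toExtData.Ext Z A} {δ' : toExtData.Ext Z' A'}
    {x : A ⟶ B} {y : B ⟶ Z} {x' : A' ⟶ B'} {y' : B' ⟶ Z'} (a : A ⟶ A') (c : Z ⟶ Z'),
    Realizes δ x y → Realizes δ' x' y' → toExtData.push a δ = toExtData.pull c δ' →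
      ∃ b : B ⟶ B', x ≫ b = a ≫ x' ∧ y ≫ c = b ≫ y'
  /-- (ET2): `𝔰(0)` is the class of the split sequence `A ⟶ A ⊕ Z ⟶ Z` -/
  realizes_zero : ∀ {A Z : C} (b : BinaryBicone A Z), b.IsBilimit →
    Realizes (0 : toExtData.Ext Z A) b.inl b.snd
  /-- (ET2): `𝔰(δ ⊕ δ') = 𝔰(δ) ⊕ 𝔰(δ')` -/
  realizes_sum : ∀ {A B Z A' B' Z' : C} {δ : toExtData.Ext Z A} {δ' : toExtData.Ext Z' A'}
    {x : A ⟶ B} {y : B ⟶ Z} {x' : A' ⟶ B'} {y' : B' ⟶ Z'},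
    Realizes δ x y → Realizes δ' x' y' →
    ∀ (bA : BinaryBicone A A') (bB : BinaryBicone B B') (bZ : BinaryBicone Z Z'),
      bA.IsBilimit → bB.IsBilimit → bZ.IsBilimit →
      Realizes (toExtData.push bA.inl (toExtData.pull bZ.fst δ) +
          toExtData.push bA.inr (toExtData.pull bZ.snd δ'))
        (bA.fst ≫ x ≫ bB.inl + bA.snd ≫ x' ≫ bB.inr)
        (bB.fst ≫ y ≫ bZ.inl + bB.snd ≫ y' ≫ bZ.inr)
  /-- (ET3) -/
  et3 : ∀ {A B Z A' B' Z' : C} {δ : toExtData.Ext Z A} {δ' : toExtData.Ext Z' A'}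
    {x : A ⟶ B} {y : B ⟶ Z} {x' : A' ⟶ B'} {y' : B' ⟶ Z'} (a : A ⟶ A') (b : B ⟶ B'),
    Realizes δ x y → Realizes δ' x' y' → x ≫ b = a ≫ x' →
      ∃ c : Z ⟶ Z', y ≫ c = b ≫ y' ∧ toExtData.push a δ = toExtData.pull c δ'
  /-- (ET3)ᵒᵖ -/
  et3_op : ∀ {A B Z A' B' Z' : C} {δ : toExtData.Ext Z A} {δ' : toExtData.Ext Z' A'}
    {x : A ⟶ B} {y : B ⟶ Z} {x' : A' ⟶ B'} {y' : B' ⟶ Z'} (b : B ⟶ B') (c : Z ⟶ Z'),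
    Realizes δ x y → Realizes δ' x' y' → y ≫ c = b ≫ y' →
      ∃ a : A ⟶ A', x ≫ b = a ≫ x' ∧ toExtData.push a δ = toExtData.pull c δ'
  /-- (ET4) -/
  et4 : ∀ {A B D G F : C} {δ : toExtData.Ext D A} {δ' : toExtData.Ext F B}
    {f : A ⟶ B} {f' : B ⟶ D} {g : B ⟶ G} {g' : G ⟶ F},
    Realizes δ f f' → Realizes δ' g g' →
      ∃ (H : C) (h' : G ⟶ H) (d : D ⟶ H) (e : H ⟶ F) (δ'' : toExtData.Ext H A),
        f' ≫ d = g ≫ h' ∧ h' ≫ e = g' ∧ Realizes δ'' (f ≫ g) h' ∧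
        Realizes (toExtData.push f' δ') d e ∧
        toExtData.pull d δ'' = δ ∧ toExtData.push f δ'' = toExtData.pull e δ'
  /-- (ET4)ᵒᵖ -/
  et4_op : ∀ {D A B F Z : C} {δ : toExtData.Ext B D} {δ' : toExtData.Ext Z F}
    {f' : D ⟶ A} {f : A ⟶ B} {g' : F ⟶ B} {g : B ⟶ Z},
    Realizes δ f' f → Realizes δ' g' g →
      ∃ (H : C) (h' : H ⟶ A) (d : D ⟶ H) (e : H ⟶ F) (δ'' : toExtData.Ext Z H),
        h' ≫ f = e ≫ g' ∧ d ≫ h' = f' ∧ Realizes δ'' h' (f ≫ g) ∧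
        Realizes (toExtData.pull g' δ) d e ∧
        toExtData.push e δ'' = δ' ∧ toExtData.push d δ = toExtData.pull g δ''

/-- A Krull--Schmidt category: every object is a finite direct sum of objects with local
endomorphism rings. -/
def IsKrullSchmidt (C : Type u) [Category.{v} C] [Preadditive C] [HasFiniteBiproducts C] : Prop :=
  ∀ M : C, ∃ (n : ℕ) (A : Fin n → C), (∀ i, IsLocalRing (End (A i))) ∧ Nonempty (M ≅ ⨁ A)

section Subcategories

variable {C : Type u} [Category.{v} C]

/-- For every `M` there is `f : A ⟶ M` with `A ∈ D` through which every morphism from an object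
of `D` to `M` factors. -/
def IsContravariantlyFinite (D : ObjectProperty C) : Prop :=
  ∀ M : C, ∃ (A : C) (f : A ⟶ M), D A ∧ ∀ (A' : C), D A' → ∀ g : A' ⟶ M, ∃ h : A' ⟶ A, h ≫ f = g

/-- The dual notion. -/
def IsCovariantlyFinite (D : ObjectProperty C) : Prop :=
  ∀ M : C, ∃ (A : C) (f : M ⟶ A), D A ∧ ∀ (A' : C), D A' → ∀ g : M ⟶ A', ∃ h : A ⟶ A', f ≫ h = g

/-- Functorially finite: both contravariantly and covariantly finite. -/
def IsFunctoriallyFinite (D : ObjectProperty C) : Prop :=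
  IsContravariantlyFinite D ∧ IsCovariantlyFinite D

variable [Preadditive C]

/-- `X^⊥`, the objects `M` with `Hom(X, M) = 0`. -/
def rightPerp (X : ObjectProperty C) : ObjectProperty C :=
  fun M => ∀ A : C, X A → ∀ f : A ⟶ M, f = 0

/-- `^⊥X`, the objects `M` with `Hom(M, X) = 0`. -/
def leftPerp (X : ObjectProperty C) : ObjectProperty C :=
  fun M => ∀ A : C, X A → ∀ f : M ⟶ A, f = 0

/-- A brick: the endomorphism ring is a division ring. -/
def IsBrick (A : C) : Prop :=
  Nontrivial (End A) ∧ ∀ f : End A, f ≠ 0 → IsUnit f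

/-- A semibrick: a set of isomorphism classes of objects (encoded as a property of objects that is
invariant under isomorphism), consisting of pairwise Hom-orthogonal bricks. -/
structure IsSemibrick (X : ObjectProperty C) : Prop where
  closedUnderIso : X.IsClosedUnderIsomorphisms
  brick : ∀ A : C, X A → IsBrick A
  orthogonal : ∀ A B : C, X A → X B → ¬ Nonempty (A ≅ B) → ∀ f : A ⟶ B, f = 0

/-- A full subcategory, closed under isomorphisms, that is closed under direct summands. -/
structure IsClosedUnderSummands (U : ObjectProperty C) : Prop where
  closedUnderIso : U.IsClosedUnderIsomorphisms
  summand : ∀ {A B : C} (b : BinaryBicone A B), b.IsBilimit → U b.pt → U A ∧ U B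

end Subcategories

namespace Extriangulated

variable {C : Type u} [Category.{v} C] [Preadditive C] [HasFiniteBiproducts C]
variable (𝔼 : Extriangulated.{w} C)

/-- `X^{⊥₁}`, the objects `M` with `E(X, M) = 0`. -/
def rightPerpOne (X : ObjectProperty C) : ObjectProperty C :=
  fun M => ∀ A : C, X A → ∀ δ : 𝔼.Ext A M, δ = 0

/-- `^{⊥₁}X`, the objects `M` with `E(M, X) = 0`. -/
def leftPerpOne (X : ObjectProperty C) : ObjectProperty C :=
  fun M => ∀ A : C, X A → ∀ δ : 𝔼.Ext M A, δ = 0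

/-- Projective objects. -/
def projectives : ObjectProperty C := fun P =>
  ∀ ⦃A B Z : C⦄ (x : A ⟶ B) (y : B ⟶ Z), 𝔼.Conflation x y → ∀ c : P ⟶ Z, ∃ b : P ⟶ B, b ≫ y = c

/-- Injective objects. -/
def injectives : ObjectProperty C := fun I =>
  ∀ ⦃A B Z : C⦄ (x : A ⟶ B) (y : B ⟶ Z), 𝔼.Conflation x y → ∀ a : A ⟶ I, ∃ b : B ⟶ I, x ≫ b = a

/-- Every object `M` has a conflation `A ⟶ P ⟶ M` with `P` projective. -/
def EnoughProjectives : Prop :=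
  ∀ M : C, ∃ (A P : C) (x : A ⟶ P) (y : P ⟶ M), 𝔼.projectives P ∧ 𝔼.Conflation x y

/-- Every object `M` has a conflation `M ⟶ I ⟶ A` with `I` injective. -/
def EnoughInjectives : Prop :=
  ∀ M : C, ∃ (I A : C) (x : M ⟶ I) (y : I ⟶ A), 𝔼.injectives I ∧ 𝔼.Conflation x y

/-- The filtration subcategory `Filt(X)`: the objects `M` that admit a finite chain of inflations
`0 = X₀ ⟶ X₁ ⟶ ⋯ ⟶ Xₙ = M` whose cones all lie in `X`. -/
inductive Filt (X : ObjectProperty C) : ObjectProperty C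
  | zero (M : C) (hM : IsZero M) : Filt X M
  | step {N M A : C} (f : N ⟶ M) (g : M ⟶ A) (hfg : 𝔼.Conflation f g)
      (hN : Filt X N) (hA : X A) : Filt X M

/-- `Y` is the subset `S_D` of `X`: `Filt(Y)` is the smallest filtration subcategory, among the
subcategories `Filt(Y')` with `Y' ⊆ X`, that contains `D`. -/
structure IsSupport (X D Y : ObjectProperty C) : Prop where
  closedUnderIso : Y.IsClosedUnderIsomorphisms
  le : Y ≤ X
  le_filt : D ≤ 𝔼.Filt Y
  minimal : ∀ Y' : ObjectProperty C, Y'.IsClosedUnderIsomorphisms → Y' ≤ X →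
    D ≤ 𝔼.Filt Y' → 𝔼.Filt Y ≤ 𝔼.Filt Y'

/-- Cotorsion pairs. -/
structure IsCotorsionPair (U V : ObjectProperty C) : Prop where
  summands_left : IsClosedUnderSummands U
  summands_right : IsClosedUnderSummands V
  ext_eq_zero : ∀ A B : C, U A → V B → ∀ δ : 𝔼.Ext A B, δ = 0
  resolution : ∀ M : C, ∃ (B A : C) (x : B ⟶ A) (y : A ⟶ M), V B ∧ U A ∧ 𝔼.Conflation x y
  coresolution : ∀ M : C, ∃ (B A : C) (x : M ⟶ B) (y : B ⟶ A), V B ∧ U A ∧ 𝔼.Conflation x y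

/-- `D` is closed under extensions. -/
def IsExtensionClosed (D : ObjectProperty C) : Prop :=
  ∀ ⦃A B Z : C⦄ (x : A ⟶ B) (y : B ⟶ Z), 𝔼.Conflation x y → D A → D Z → D B

/-! ### The extriangulated structure of an extension-closed subcategory -/

/-- The restriction of `E` and `𝔰` to a full subcategory: an `E`-triangle of the subcategory is an
`E`-triangle of `C` with all three terms in the subcategory. -/
def restrictData (D : ObjectProperty C) : ExtData.{w} D.FullSubcategory where
  E := D.ι.op ⋙ 𝔼.E ⋙ (Functor.whiskeringLeft _ _ _).obj D.ι
  Realizes {A B Z} δ x y := 𝔼.Realizes (A := A.obj) (B := B.obj) (Z := Z.obj) δ x.hom y.hom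

/-- An extension-closed full subcategory that is additive is extriangulated. -/
def restrict (D : ObjectProperty C) [HasFiniteBiproducts D.FullSubcategory]
    (hD : 𝔼.IsExtensionClosed D) : Extriangulated.{w} D.FullSubcategory where
  toExtData := 𝔼.restrictData D
  additive_fst := by
    have := 𝔼.additive_fst
    dsimp only [restrictData]
    infer_instance
  additive_snd Z := by
    have := 𝔼.additive_snd
    dsimp only [restrictData]
    exact inferInstanceAs (D.ι ⋙ 𝔼.E.obj (op Z.unop.obj)).Additive
  exists_realizes {A Z} δ := by
    obtain ⟨B, x, y, h⟩ := 𝔼.exists_realizes (A := A.obj) (Z := Z.obj) δ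
    exact ⟨⟨B, hD x y ⟨_, h⟩ A.property Z.property⟩, ObjectProperty.homMk x,
      ObjectProperty.homMk y, h⟩
  realizes_iff {A B B' Z δ x y} h x' y' := by
    refine (𝔼.realizes_iff (A := A.obj) (Z := Z.obj) h x'.hom y'.hom).trans ⟨?_, ?_⟩
    · rintro ⟨b, h₁, h₂⟩
      exact ⟨ObjectProperty.isoMk _ b, by ext; exact h₁, by ext; exact h₂⟩
    · rintro ⟨b, h₁, h₂⟩
      exact ⟨D.ι.mapIso b, congrArg (fun f => f.hom) h₁, congrArg (fun f => f.hom) h₂⟩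
  realize_hom {A B Z A' B' Z' δ δ' x y x' y'} a c h h' hac := by
    obtain ⟨b, h₁, h₂⟩ := 𝔼.realize_hom (A := A.obj) (Z := Z.obj) (A' := A'.obj) (Z' := Z'.obj)
      a.hom c.hom h h' hac
    exact ⟨ObjectProperty.homMk b, by ext; exact h₁, by ext; exact h₂⟩
  realizes_zero {A Z} b hb := by
    have := preservesBinaryBiproducts_of_preservesBiproducts D.ι
    exact 𝔼.realizes_zero (D.ι.mapBinaryBicone b) (isBinaryBilimitOfPreserves D.ι hb)
  realizes_sum {A B Z A' B' Z' δ δ' x y x' y'} h h' bA bB bZ hA hB hZ := by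
    have := preservesBinaryBiproducts_of_preservesBiproducts D.ι
    exact 𝔼.realizes_sum (A := A.obj) (Z := Z.obj) (A' := A'.obj) (Z' := Z'.obj) h h'
      (D.ι.mapBinaryBicone bA) (D.ι.mapBinaryBicone bB) (D.ι.mapBinaryBicone bZ)
      (isBinaryBilimitOfPreserves D.ι hA) (isBinaryBilimitOfPreserves D.ι hB)
      (isBinaryBilimitOfPreserves D.ι hZ)
  et3 {A B Z A' B' Z' δ δ' x y x' y'} a b h h' hab := by
    obtain ⟨c, h₁, h₂⟩ := 𝔼.et3 (A := A.obj) (Z := Z.obj) (A' := A'.obj) (Z' := Z'.obj)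
      a.hom b.hom h h' (congrArg (fun f => f.hom) hab)
    exact ⟨ObjectProperty.homMk c, by ext; exact h₁, h₂⟩
  et3_op {A B Z A' B' Z' δ δ' x y x' y'} b c h h' hbc := by
    obtain ⟨a, h₁, h₂⟩ := 𝔼.et3_op (A := A.obj) (Z := Z.obj) (A' := A'.obj) (Z' := Z'.obj)
      b.hom c.hom h h' (congrArg (fun f => f.hom) hbc)
    exact ⟨ObjectProperty.homMk a, by ext; exact h₁, h₂⟩
  et4 {A B K G F δ δ' f f' g g'} h h' := by
    obtain ⟨H, k, d, e, δ'', h₁, h₂, h₃, h₄, h₅, h₆⟩ :=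
      𝔼.et4 (A := A.obj) (B := B.obj) (D := K.obj) (F := F.obj) h h'
    exact ⟨⟨H, hD d e ⟨_, h₄⟩ K.property F.property⟩, ObjectProperty.homMk k,
      ObjectProperty.homMk d, ObjectProperty.homMk e, δ'', by ext; exact h₁, by ext; exact h₂,
      h₃, h₄, h₅, h₆⟩
  et4_op {K A B F Z δ δ' f' f g' g} h h' := by
    obtain ⟨H, k, d, e, δ'', h₁, h₂, h₃, h₄, h₅, h₆⟩ :=
      𝔼.et4_op (D := K.obj) (B := B.obj) (F := F.obj) (Z := Z.obj) h h'
    exact ⟨⟨H, hD d e ⟨_, h₄⟩ K.property F.property⟩, ObjectProperty.homMk k,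
      ObjectProperty.homMk d, ObjectProperty.homMk e, δ'', by ext; exact h₁, by ext; exact h₂,
      h₃, h₄, h₅, h₆⟩

/-! ### `Filt(X)` is additive and closed under extensions -/

theorem realizes_of_iso {A B B' Z : C} {δ : 𝔼.Ext Z A} {x : A ⟶ B} {y : B ⟶ Z}
    (h : 𝔼.Realizes δ x y) (b : B ≅ B') : 𝔼.Realizes δ (x ≫ b.hom) (b.inv ≫ y) :=
  (𝔼.realizes_iff h _ _).2 ⟨b, rfl, by simp⟩

theorem filt_of_iso (X : ObjectProperty C) {M M' : C} (e : M ≅ M') (h : 𝔼.Filt X M) :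
    𝔼.Filt X M' := by
  cases h with
  | zero _ hM => exact .zero _ (hM.of_iso e.symm)
  | step f g hfg hN hA =>
    obtain ⟨δ, hδ⟩ := hfg
    exact .step _ _ ⟨δ, 𝔼.realizes_of_iso hδ e⟩ hN hA

theorem filt_extensionClosed (X : ObjectProperty C) : 𝔼.IsExtensionClosed (𝔼.Filt X) := by
  intro A B Z x y hxy hA hZ
  induction hZ generalizing B with
  | zero Z hZ =>
    obtain ⟨δ, hδ⟩ := hxy
    have hadd := 𝔼.additive_fst
    have h0 : IsZero ((𝔼.E.obj (op Z)).obj A) :=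
      ((Functor.map_isZero 𝔼.E hZ.op).obj A)
    have hδ0 : δ = 0 := by
      have := AddCommGrpCat.subsingleton_of_isZero h0
      exact Subsingleton.elim _ _
    subst hδ0
    let b : BinaryBicone A Z :=
      { pt := A, fst := 𝟙 A, snd := 0, inl := 𝟙 A, inr := 0
        inr_snd := hZ.eq_of_src _ _ }
    have hb : b.IsBilimit := isBinaryBilimitOfTotal b (by simp [b])
    obtain ⟨e, -, -⟩ := (𝔼.realizes_iff (𝔼.realizes_zero b hb) x y).1 hδ
    exact 𝔼.filt_of_iso X e hA
  | step f g hfg hN hT ih =>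
    obtain ⟨δ, hδ⟩ := hxy
    obtain ⟨δ', hδ'⟩ := hfg
    obtain ⟨H, h', d, e, δ'', -, -, h₃, h₄, -, -⟩ := 𝔼.et4_op hδ hδ'
    exact .step _ _ ⟨_, h₃⟩ (ih d e ⟨_, h₄⟩) hT

instance filt_hasFiniteBiproducts (X : ObjectProperty C) :
    HasFiniteBiproducts (𝔼.Filt X).FullSubcategory := by
  have := hasBinaryBiproducts_of_finite_biproducts C
  have : HasZeroObject C := hasZeroObject_of_hasFiniteBiproducts C
  open ZeroObject in
  have : (𝔼.Filt X).ContainsZero :=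
    ⟨⟨0, isZero_zero C, .zero _ (isZero_zero C)⟩⟩
  have : HasBinaryBiproducts (𝔼.Filt X).FullSubcategory := ⟨fun A B =>
    let b : BinaryBicone A B :=
      { pt := ⟨A.obj ⊞ B.obj, 𝔼.filt_extensionClosed X biprod.inl biprod.snd
          ⟨0, 𝔼.realizes_zero _ (BinaryBiproduct.isBilimit A.obj B.obj)⟩ A.property B.property⟩
        fst := ObjectProperty.homMk biprod.fst
        snd := ObjectProperty.homMk biprod.snd
        inl := ObjectProperty.homMk biprod.inl
        inr := ObjectProperty.homMk biprod.inr
        inl_fst := by ext; simp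
        inl_snd := by ext; simp
        inr_fst := by ext; simp
        inr_snd := by ext; simp }
    HasBinaryBiproduct.mk ⟨b, isBinaryBilimitOfTotal b (ObjectProperty.hom_ext _
      (biprod.total (X := A.obj) (Y := B.obj)))⟩⟩
  have : HasFiniteProducts (𝔼.Filt X).FullSubcategory :=
    hasFiniteProducts_of_has_binary_and_terminal
  exact HasFiniteBiproducts.of_hasFiniteProducts

/-- The extriangulated category `T = Filt(X)`, with the structure inherited from `C`. -/
def filtCat (X : ObjectProperty C) : Extriangulated.{w} (𝔼.Filt X).FullSubcategory :=
  𝔼.restrict (𝔼.Filt X) (𝔼.filt_extensionClosed X)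

/-- A collection `S` of objects of `C`, regarded as a collection of objects of `T = Filt(X)`. -/
abbrev inFilt (X S : ObjectProperty C) : ObjectProperty (𝔼.Filt X).FullSubcategory :=
  S.inverseImage (𝔼.Filt X).ι

end Extriangulated

/-! Inside `T` the members of `X` behave like the simple objects of a length category. The precise
form is `exists_conflation_of_ne_zero`: if `M` has a filtration of length `n` with factors in `Y ⊆
X`, then a nonzero morphism to `M` from a member of `X` is an inflation, its source lies in `Y`, and
its cone has a `Y`-filtration of length `n - 1`. Every nonzero filtered object receives such a
morphism, so one may divide out a brick and induct on the length.

This yields (1), and then contravariant finiteness, because every morphism from `Filt(S)` to an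
object of `S^⊥` vanishes. The same induction shows that `Filt(Y)` is closed under summands and that
`Filt` commutes with intersections of subsets of `X` (`filt_iInf`), so that the smallest filtration
subcategory containing `D` exists.

For the cotorsion pair, the inclusion of the projectives in `Filt(S)` allows approximations `U ⟶ M`
that are deflations. Take one with `U` of minimal length. No brick of `S` maps nontrivially to `U`
with zero composite to `M`, so every endomorphism of `U` over `M` is an isomorphism
(`isIso_of_injective_on_socle`): minimal length takes the role of right minimality. Wakamatsu's
argument then puts the cocone in `S^{⊥₁}` (`exists_special_precover`), and Salce's pullback argument
gives the coresolutions. The dual halves come from the extriangulated structure on `Cᵒᵖ`. -/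

namespace ExtData

/-! ### Functoriality of `E` -/

section

variable {C : Type u} [Category.{v} C] (𝔼 : ExtData.{w} C)

theorem push_id {Z A : C} (δ : 𝔼.Ext Z A) : 𝔼.push (𝟙 A) δ = δ := by
  simp [push]

theorem push_comp {Z A A' A'' : C} (a : A ⟶ A') (a' : A' ⟶ A'') (δ : 𝔼.Ext Z A) :
    𝔼.push (a ≫ a') δ = 𝔼.push a' (𝔼.push a δ) := by
  simp [push]

theorem pull_id {Z A : C} (δ : 𝔼.Ext Z A) : 𝔼.pull (𝟙 Z) δ = δ := by
  simp [pull]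

theorem pull_comp {Z Z' Z'' A : C} (c' : Z'' ⟶ Z') (c : Z' ⟶ Z) (δ : 𝔼.Ext Z A) :
    𝔼.pull (c' ≫ c) δ = 𝔼.pull c' (𝔼.pull c δ) := by
  simp [pull]

theorem push_pull {Z Z' A A' : C} (a : A ⟶ A') (c : Z' ⟶ Z) (δ : 𝔼.Ext Z A) :
    𝔼.push a (𝔼.pull c δ) = 𝔼.pull c (𝔼.push a δ) := by
  exact (congrArg (fun f => f.hom δ) ((𝔼.E.map c.op).naturality a)).symm

theorem push_zero {Z A A' : C} (a : A ⟶ A') : 𝔼.push a (0 : 𝔼.Ext Z A) = 0 :=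
  map_zero _

theorem pull_zero {Z Z' A : C} (c : Z' ⟶ Z) : 𝔼.pull c (0 : 𝔼.Ext Z A) = 0 :=
  map_zero _

end

end ExtData

/-! ### Elementary consequences of the axioms -/

namespace Extriangulated

theorem isIso_of_comp_isIso {C : Type u} [Category.{v} C] {B B' : C} {b : B ⟶ B'}
    {b' : B' ⟶ B} (h₁ : IsIso (b ≫ b')) (h₂ : IsIso (b' ≫ b)) : IsIso b := by
  have : IsSplitMono b := ⟨⟨⟨b' ≫ inv (b ≫ b'), by rw [← Category.assoc]; simp⟩⟩⟩
  have : Epi b := epi_of_epi b' b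
  exact isIso_of_epi_of_isSplitMono b

/-- Writing `e = 1 + n` with `n² = 0`, the inverse is `1 - n = 2 - e`. -/
theorem isIso_of_sub_id_comp_self {C : Type u} [Category.{v} C] [Preadditive C] {A : C}
    (e : A ⟶ A) (h : (e - 𝟙 A) ≫ (e - 𝟙 A) = 0) :
    IsIso e := by
  have h' : e ≫ e = e + e - 𝟙 A := by
    have : e ≫ e - e - (e - 𝟙 A) = 0 := by simpa using h
    rw [sub_sub, sub_eq_zero] at this
    rw [this]; abel
  refine ⟨𝟙 A + 𝟙 A - e, ?_, ?_⟩
  · simp only [Preadditive.comp_sub, Preadditive.comp_add, Category.comp_id, h']; abel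
  · simp only [Preadditive.sub_comp, Preadditive.add_comp, Category.id_comp, h']; abel

variable {C : Type u} [Category.{v} C] [Preadditive C] [HasFiniteBiproducts C]
variable (𝔼 : Extriangulated.{w} C)

theorem sub_push {Z A A' : C} (a a' : A ⟶ A') (δ : 𝔼.Ext Z A) :
    𝔼.push (a - a') δ = 𝔼.push a δ - 𝔼.push a' δ := by
  have := 𝔼.additive_snd (op Z)
  simp [ExtData.push, Functor.map_sub]

theorem zero_push {Z A A' : C} (δ : 𝔼.Ext Z A) : 𝔼.push (0 : A ⟶ A') δ = 0 := by
  simpa using 𝔼.sub_push (0 : A ⟶ A') 0 δ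

theorem sub_pull {Z Z' A : C} (c c' : Z' ⟶ Z) (δ : 𝔼.Ext Z A) :
    𝔼.pull (c - c') δ = 𝔼.pull c δ - 𝔼.pull c' δ := by
  have := 𝔼.additive_fst
  simp [ExtData.pull]

theorem zero_pull {Z Z' A : C} (δ : 𝔼.Ext Z A) : 𝔼.pull (0 : Z' ⟶ Z) δ = 0 := by
  simpa using 𝔼.sub_pull (0 : Z' ⟶ Z) 0 δ

theorem exists_isZero (C : Type u) [Category.{v} C] [Preadditive C] [HasFiniteBiproducts C] :
    ∃ O : C, IsZero O :=
  have := hasZeroObject_of_hasFiniteBiproducts C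
  HasZeroObject.zero

theorem ext_eq_zero_of_isZero_right {Z A : C} (hA : IsZero A) (δ : 𝔼.Ext Z A) : δ = 0 := by
  rw [← 𝔼.push_id δ, hA.eq_of_src (𝟙 A) 0, zero_push]

theorem ext_eq_zero_of_isZero_left {Z A : C} (hZ : IsZero Z) (δ : 𝔼.Ext Z A) : δ = 0 := by
  rw [← 𝔼.pull_id δ, hZ.eq_of_src (𝟙 Z) 0, zero_pull]

/-- The triangles `A ⟶ A ⟶ 0` and `0 ⟶ A ⟶ A` serve as test objects: comparing a triangle with them
through (ET2), (ET3) and (ET3)ᵒᵖ gives the exactness statements below. -/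
theorem realizes_id_left (A : C) {O : C} (hO : IsZero O) :
    𝔼.Realizes (0 : 𝔼.Ext O A) (𝟙 A) (0 : A ⟶ O) := by
  let b : BinaryBicone A O :=
    { pt := A, fst := 𝟙 A, snd := 0, inl := 𝟙 A, inr := 0, inr_snd := hO.eq_of_src _ _ }
  exact 𝔼.realizes_zero b (isBinaryBilimitOfTotal b (by simp [b]))

theorem realizes_id_right (A : C) {O : C} (hO : IsZero O) :
    𝔼.Realizes (0 : 𝔼.Ext A O) (0 : O ⟶ A) (𝟙 A) := by
  let b : BinaryBicone O A :=
    { pt := A, fst := 0, snd := 𝟙 A, inl := 0, inr := 𝟙 A, inl_fst := hO.eq_of_src _ _ }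
  exact 𝔼.realizes_zero b (isBinaryBilimitOfTotal b (by simp [b]))

/-! ### Exactness of the Hom–`E` sequences -/

section Exactness

variable {𝔼} {A B Z : C} {δ : 𝔼.Ext Z A} {x : A ⟶ B} {y : B ⟶ Z}

theorem comp_eq_zero (h : 𝔼.Realizes δ x y) : x ≫ y = 0 := by
  obtain ⟨O, hO⟩ := exists_isZero C
  obtain ⟨c, hc, -⟩ := 𝔼.et3 (𝟙 A) x (𝔼.realizes_id_left A hO) h rfl
  simpa using hc.symm

theorem push_eq_zero (h : 𝔼.Realizes δ x y) : 𝔼.push x δ = 0 := by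
  obtain ⟨O, hO⟩ := exists_isZero C
  obtain ⟨c, -, hc⟩ := 𝔼.et3 x (𝟙 B) h (𝔼.realizes_id_left B hO) rfl
  rw [hc, ExtData.pull_zero]

theorem pull_eq_zero (h : 𝔼.Realizes δ x y) : 𝔼.pull y δ = 0 := by
  obtain ⟨O, hO⟩ := exists_isZero C
  obtain ⟨a, -, ha⟩ := 𝔼.et3_op (𝟙 B) y (𝔼.realizes_id_right B hO) h rfl
  rw [← ha, ExtData.push_zero]

theorem exists_extend (h : 𝔼.Realizes δ x y) {W : C} (a : A ⟶ W) (ha : 𝔼.push a δ = 0) :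
    ∃ b : B ⟶ W, x ≫ b = a := by
  obtain ⟨O, hO⟩ := exists_isZero C
  obtain ⟨b, hb, -⟩ := 𝔼.realize_hom a (0 : Z ⟶ O) h (𝔼.realizes_id_left W hO)
    (by rw [ha, ExtData.pull_zero])
  exact ⟨b, by simpa using hb⟩

theorem exists_lift (h : 𝔼.Realizes δ x y) {W : C} (c : W ⟶ Z) (hc : 𝔼.pull c δ = 0) :
    ∃ b : W ⟶ B, b ≫ y = c := by
  obtain ⟨O, hO⟩ := exists_isZero C
  obtain ⟨b, -, hb⟩ := 𝔼.realize_hom (0 : O ⟶ A) c (𝔼.realizes_id_right W hO) h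
    (by rw [hc, ExtData.push_zero])
  exact ⟨b, by simpa using hb.symm⟩

theorem exists_factor_inflation (h : 𝔼.Realizes δ x y) {W : C} (f : W ⟶ B) (hf : f ≫ y = 0) :
    ∃ t : W ⟶ A, t ≫ x = f := by
  obtain ⟨O, hO⟩ := exists_isZero C
  obtain ⟨t, ht, -⟩ := 𝔼.et3_op f (0 : O ⟶ Z) (𝔼.realizes_id_left W hO) h (by simp [hf])
  exact ⟨t, by simpa using ht.symm⟩

theorem exists_factor_deflation (h : 𝔼.Realizes δ x y) {W : C} (f : B ⟶ W) (hf : x ≫ f = 0) :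
    ∃ t : Z ⟶ W, y ≫ t = f := by
  obtain ⟨O, hO⟩ := exists_isZero C
  obtain ⟨t, ht, -⟩ := 𝔼.et3 (0 : A ⟶ O) f h (𝔼.realizes_id_right W hO) (by simp [hf])
  exact ⟨t, by simpa using ht⟩

end Exactness

/-! ### The five lemma -/

section FiveLemma

variable {𝔼} {A B Z : C} {δ : 𝔼.Ext Z A} {x : A ⟶ B} {y : B ⟶ Z}

/-- The difference `b - 1` factors through `x` and is killed by `x` from the left, so its square is
zero. The two variants for the ends use the same trick, with a lift or an extension obtained from
`δ`. -/
theorem isIso_middle_of_id (h : 𝔼.Realizes δ x y) (b : B ⟶ B) (hx : x ≫ b = x) (hy : b ≫ y = y) :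
    IsIso b := by
  obtain ⟨t, ht⟩ := exists_factor_inflation h (b - 𝟙 B) (by simp [hy])
  apply isIso_of_sub_id_comp_self
  nth_rw 1 [← ht]
  rw [Category.assoc]
  simp [hx]

theorem isIso_cone_of_id (h : 𝔼.Realizes δ x y) (c : Z ⟶ Z) (hy : y ≫ c = y)
    (hc : 𝔼.pull c δ = δ) : IsIso c := by
  obtain ⟨t, ht⟩ := exists_lift h (c - 𝟙 Z) (by rw [sub_pull, hc, ExtData.pull_id, sub_self])
  apply isIso_of_sub_id_comp_self
  nth_rw 1 [← ht]
  rw [Category.assoc]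
  simp [hy]

theorem isIso_cocone_of_id (h : 𝔼.Realizes δ x y) (a : A ⟶ A) (hx : a ≫ x = x)
    (ha : 𝔼.push a δ = δ) : IsIso a := by
  obtain ⟨t, ht⟩ := exists_extend h (a - 𝟙 A) (by rw [sub_push, ha, ExtData.push_id, sub_self])
  apply isIso_of_sub_id_comp_self
  nth_rw 2 [← ht]
  rw [← Category.assoc]
  simp [hx]

variable {A' B' Z' : C} {δ' : 𝔼.Ext Z' A'} {x' : A' ⟶ B'} {y' : B' ⟶ Z'}

/-- The five lemma for morphisms of `E`-triangles. -/
theorem isIso_middle (h : 𝔼.Realizes δ x y) (h' : 𝔼.Realizes δ' x' y') (a : A ⟶ A') (b : B ⟶ B')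
    (c : Z ⟶ Z') (hab : x ≫ b = a ≫ x') (hbc : y ≫ c = b ≫ y')
    (hac : 𝔼.push a δ = 𝔼.pull c δ') [IsIso a] [IsIso c] : IsIso b := by
  -- The lift `b'` need not invert `b`, but both composites are the identity on the two ends, which
  -- is enough.
  obtain ⟨b', hb₁, hb₂⟩ := 𝔼.realize_hom (inv a) (inv c) h' h (by
    have : δ' = 𝔼.pull (inv c) (𝔼.push a δ) := by
      rw [hac, ← ExtData.pull_comp, IsIso.inv_hom_id, ExtData.pull_id]
    rw [this, ExtData.push_pull, ← ExtData.push_comp, IsIso.hom_inv_id, ExtData.push_id])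
  refine isIso_of_comp_isIso (b' := b') (isIso_middle_of_id h _ ?_ ?_)
    (isIso_middle_of_id h' _ ?_ ?_)
  · rw [reassoc_of% hab, hb₁]; simp
  · rw [Category.assoc, ← hb₂, ← reassoc_of% hbc]; simp
  · rw [reassoc_of% hb₁, hab]; simp
  · rw [Category.assoc, ← hbc, ← reassoc_of% hb₂]; simp

end FiveLemma

/-! ### Isomorphisms, retracts and splittings of conflations -/

section Transport

variable {𝔼} {A B Z : C} {x : A ⟶ B} {y : B ⟶ Z}

theorem conflation_of_iso_left (h : 𝔼.Conflation x y) {A' : C} (e : A' ≅ A) :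
    𝔼.Conflation (e.hom ≫ x) y := by
  obtain ⟨δ, h⟩ := h
  obtain ⟨B', x', y', h'⟩ := 𝔼.exists_realizes (𝔼.push e.inv δ)
  obtain ⟨b, hb₁, hb₂⟩ := 𝔼.realize_hom e.inv (𝟙 Z) h h' (by rw [ExtData.pull_id])
  have : IsIso b := isIso_middle h h' e.inv b (𝟙 Z) hb₁ hb₂ (by rw [ExtData.pull_id])
  refine ⟨_, (𝔼.realizes_iff h' _ _).2 ⟨(asIso b).symm, ?_, ?_⟩⟩
  · simp [hb₁]
  · simpa using hb₂

theorem conflation_of_iso_middle (h : 𝔼.Conflation x y) {B' : C} (e : B ≅ B') :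
    𝔼.Conflation (x ≫ e.hom) (e.inv ≫ y) :=
  ⟨_, 𝔼.realizes_of_iso h.choose_spec e⟩

/-- An inflation that is a retract of another one with the same source has a cone that is a
retract of the cone of the latter. -/
theorem exists_retract_cone (h : 𝔼.Conflation x y) {B' Z' : C} {x' : A ⟶ B'} {y' : B' ⟶ Z'}
    (h' : 𝔼.Conflation x' y') (i : B ⟶ B') (r : B' ⟶ B) (hir : i ≫ r = 𝟙 B) (hi : x ≫ i = x')
    (hr : x' ≫ r = x) : Nonempty (Retract Z Z') := by
  obtain ⟨δ, h⟩ := h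
  obtain ⟨δ', h'⟩ := h'
  obtain ⟨c, hc, hc'⟩ := 𝔼.et3 (𝟙 A) i h h' (by simp [hi])
  obtain ⟨d, hd, hd'⟩ := 𝔼.et3 (𝟙 A) r h' h (by simp [hr])
  rw [ExtData.push_id] at hc' hd'
  -- The composite `c ≫ d` need not be the identity; it fixes `y` and `δ`, so it is invertible and
  -- `d` can be corrected to a retraction.
  have : IsIso (c ≫ d) := isIso_cone_of_id h _
    (by rw [reassoc_of% hc, hd, reassoc_of% hir])
    (by rw [ExtData.pull_comp, ← hd', ← hc'])
  exact ⟨⟨c, d ≫ inv (c ≫ d), by rw [← Category.assoc]; simp⟩⟩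

theorem exists_retract_cocone (h : 𝔼.Conflation x y) {A' B' : C} {x' : A' ⟶ B'} {y' : B' ⟶ Z}
    (h' : 𝔼.Conflation x' y') (i : B ⟶ B') (r : B' ⟶ B) (hir : i ≫ r = 𝟙 B) (hi : i ≫ y' = y)
    (hr : r ≫ y = y') : Nonempty (Retract A A') := by
  obtain ⟨δ, h⟩ := h
  obtain ⟨δ', h'⟩ := h'
  obtain ⟨a, ha, ha'⟩ := 𝔼.et3_op i (𝟙 Z) h h' (by simp [hi])
  obtain ⟨d, hd, hd'⟩ := 𝔼.et3_op r (𝟙 Z) h' h (by simp [hr])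
  rw [ExtData.pull_id] at ha' hd'
  have : IsIso (a ≫ d) := isIso_cocone_of_id h _
    (by rw [Category.assoc, ← hd, ← reassoc_of% ha, hir, Category.comp_id])
    (by rw [ExtData.push_comp, ha', hd'])
  exact ⟨⟨a, d ≫ inv (a ≫ d), by rw [← Category.assoc]; simp⟩⟩

/-- Cones are unique up to isomorphism. -/
theorem nonempty_cone_iso (h : 𝔼.Conflation x y) {Z' : C} {y' : B ⟶ Z'}
    (h' : 𝔼.Conflation x y') : Nonempty (Z ≅ Z') := by
  obtain ⟨δ, h⟩ := h
  obtain ⟨δ', h'⟩ := h'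
  obtain ⟨c, hc, hc'⟩ := 𝔼.et3 (𝟙 A) (𝟙 B) h h' (by simp)
  obtain ⟨d, hd, hd'⟩ := 𝔼.et3 (𝟙 A) (𝟙 B) h' h (by simp)
  rw [ExtData.push_id] at hc' hd'
  rw [Category.id_comp] at hc hd
  have : IsIso c := isIso_of_comp_isIso (b' := d)
    (isIso_cone_of_id h _ (by rw [reassoc_of% hc, hd])
      (by rw [ExtData.pull_comp, ← hd', ← hc']))
    (isIso_cone_of_id h' _ (by rw [reassoc_of% hd, hc])
      (by rw [ExtData.pull_comp, ← hc', ← hd']))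
  exact ⟨asIso c⟩

theorem conflation_id_left (A : C) {O : C} (hO : IsZero O) : 𝔼.Conflation (𝟙 A) (0 : A ⟶ O) :=
  ⟨0, 𝔼.realizes_id_left A hO⟩

theorem isIso_of_conflation_isZero_left (h : 𝔼.Conflation x y) (hA : IsZero A) : IsIso y := by
  obtain ⟨δ, h⟩ := h
  obtain ⟨t, ht⟩ := exists_factor_deflation h (𝟙 B) (hA.eq_of_src _ _)
  obtain ⟨s, hs⟩ := exists_lift h (𝟙 Z) (𝔼.ext_eq_zero_of_isZero_right hA _)
  have hst : s = t := by
    rw [← Category.comp_id s, ← ht, reassoc_of% hs]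
  exact ⟨t, ht, hst ▸ hs⟩

/-- A deflation with a section is a split one. -/
theorem conflation_of_section (h : 𝔼.Conflation x y) (s : Z ⟶ B) (hs : s ≫ y = 𝟙 Z) :
    ∃ r : B ⟶ A, x ≫ r = 𝟙 A ∧ s ≫ r = 0 ∧ r ≫ x + y ≫ s = 𝟙 B := by
  obtain ⟨δ, h⟩ := h
  have hδ : δ = 0 := by
    rw [← 𝔼.pull_id δ, ← hs, ExtData.pull_comp, pull_eq_zero h, ExtData.pull_zero]
  -- The retraction `r₀` need not vanish on `s`; it only serves to cancel `x` on the right. The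
  -- projection wanted is `r`.
  obtain ⟨r₀, hr₀⟩ := exists_extend h (𝟙 A) (by rw [hδ, ExtData.push_zero])
  obtain ⟨r, hr⟩ := exists_factor_inflation h (𝟙 B - y ≫ s) (by simp [hs])
  have hxy := comp_eq_zero h
  have h₁ : x ≫ r ≫ x = x := by rw [hr]; simp [reassoc_of% hxy]
  have h₂ : s ≫ r ≫ x = 0 := by rw [hr]; simp [reassoc_of% hs]
  refine ⟨r, ?_, ?_, by rw [hr]; simp⟩
  · rw [← Category.comp_id (x ≫ r), ← hr₀, Category.assoc, reassoc_of% h₁]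
  · rw [← Category.comp_id (s ≫ r), ← hr₀, Category.assoc, reassoc_of% h₂, zero_comp]

theorem conflation_of_total {r : B ⟶ A} {s : Z ⟶ B} (h₁ : x ≫ r = 𝟙 A) (h₂ : s ≫ y = 𝟙 Z)
    (h₃ : x ≫ y = 0) (h₄ : s ≫ r = 0) (h₅ : r ≫ x + y ≫ s = 𝟙 B) : 𝔼.Conflation x y := by
  let b : BinaryBicone A Z :=
    { pt := B, fst := r, snd := y, inl := x, inr := s, inl_fst := h₁, inl_snd := h₃,
      inr_fst := h₄, inr_snd := h₂ }
  exact ⟨0, 𝔼.realizes_zero b (isBinaryBilimitOfTotal b h₅)⟩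

end Transport

end Extriangulated

/-! ### Semibricks and filtrations -/

/-- Schur's lemma: orthogonality makes the two bricks isomorphic, and a nonzero endomorphism of a
brick is invertible. -/
theorem IsSemibrick.isIso_of_ne_zero {C : Type u} [Category.{v} C] [Preadditive C]
    {X : ObjectProperty C} (hX : IsSemibrick X) {A B : C} (hA : X A) (hB : X B) {f : A ⟶ B}
    (hf : f ≠ 0) : IsIso f := by
  have ⟨e⟩ : Nonempty (A ≅ B) := by
    by_contra h
    exact hf (hX.orthogonal A B hA hB h f)
  have h₁ : f ≫ e.inv ≠ 0 := fun h => hf (by simpa using h =≫ e.hom)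
  have : IsIso (f ≫ e.inv) := (isUnit_iff_isIso _).1 ((hX.brick A hA).2 _ h₁)
  exact IsIso.of_isIso_comp_right f e.inv

theorem IsSemibrick.id_ne_zero {C : Type u} [Category.{v} C] [Preadditive C]
    {X : ObjectProperty C} (hX : IsSemibrick X) {A : C} (hA : X A) : 𝟙 A ≠ 0 := by
  have := (hX.brick A hA).1
  exact one_ne_zero (α := End A)

namespace Extriangulated

variable {C : Type u} [Category.{v} C] [Preadditive C] [HasFiniteBiproducts C]
variable (𝔼 : Extriangulated.{w} C)

/-- The objects with a filtration with `n` factors in `X`; the filtrations are built from the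
subobjects, in contrast to those of `Filt`. -/
inductive FiltN (X : ObjectProperty C) : ℕ → ObjectProperty C
  | zero (M : C) (hM : IsZero M) : FiltN X 0 M
  | step {n : ℕ} {A M N : C} (f : A ⟶ M) (g : M ⟶ N) (hfg : 𝔼.Conflation f g)
      (hA : X A) (hN : FiltN X n N) : FiltN X (n + 1) M

variable {𝔼} {X Y : ObjectProperty C}

theorem filt_of_mem {A : C} (hA : X A) : 𝔼.Filt X A := by
  obtain ⟨O, hO⟩ := exists_isZero C
  exact .step (0 : O ⟶ A) (𝟙 A) ⟨_, 𝔼.realizes_id_right A hO⟩ (.zero O hO) hA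

theorem filt_mono (h : X ≤ Y) : 𝔼.Filt X ≤ 𝔼.Filt Y := by
  intro M hM
  induction hM with
  | zero M hM => exact .zero M hM
  | step f g hfg _ hA ih => exact .step f g hfg ih (h _ hA)

theorem FiltN.of_iso {n : ℕ} {M M' : C} (hM : 𝔼.FiltN X n M) (e : M ≅ M') : 𝔼.FiltN X n M' := by
  cases hM with
  | zero _ hM => exact .zero _ (hM.of_iso e.symm)
  | step f g hfg hA hN => exact .step _ _ (conflation_of_iso_middle hfg e) hA hN

theorem FiltN.filt {n : ℕ} {M : C} (hM : 𝔼.FiltN X n M) : 𝔼.Filt X M := by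
  induction hM with
  | zero M hM => exact .zero M hM
  | step f g hfg hA _ ih => exact 𝔼.filt_extensionClosed X f g hfg (filt_of_mem hA) ih

/-- (ET4) shows that the cone of the bottom factor of `M'` in `M` is again an extension of `A`, now
by an object of smaller length. This makes the filtrations built from below agree with those of
`Filt`. -/
theorem FiltN.append {n : ℕ} {M' : C} (hM' : 𝔼.FiltN X n M') {M A : C} {f : M' ⟶ M} {g : M ⟶ A}
    (hfg : 𝔼.Conflation f g) (hA : X A) : 𝔼.FiltN X (n + 1) M := by
  induction hM' generalizing M with
  | zero M' hM' =>
    obtain ⟨O, hO⟩ := exists_isZero C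
    have := isIso_of_conflation_isZero_left hfg hM'
    exact .step _ _ (conflation_of_iso_middle (𝔼.conflation_id_left A hO) (asIso g).symm) hA
      (.zero O hO)
  | step x y hxy hB _ ih =>
    obtain ⟨δ, hxy⟩ := hxy
    obtain ⟨δ', hfg⟩ := hfg
    obtain ⟨H, h', d, e, δ'', -, -, h₁, h₂, -⟩ := 𝔼.et4 hxy hfg
    exact .step _ _ ⟨_, h₁⟩ hB (ih ⟨_, h₂⟩)

theorem filt_iff_exists_filtN {M : C} : 𝔼.Filt X M ↔ ∃ n, 𝔼.FiltN X n M := by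
  refine ⟨fun hM => ?_, fun ⟨n, hn⟩ => hn.filt⟩
  induction hM with
  | zero M hM => exact ⟨0, .zero M hM⟩
  | step f g hfg _ hA ih =>
    obtain ⟨n, hn⟩ := ih
    exact ⟨n + 1, hn.append hfg hA⟩

/-- `Hom(-, W)` vanishes on `Filt(Y)` if it vanishes on `Y`. -/
theorem eq_zero_of_filt {W : C} (hW : rightPerp Y W) {M : C} (hM : 𝔼.Filt Y M) (f : M ⟶ W) :
    f = 0 := by
  induction hM with
  | zero M hM => exact hM.eq_of_src _ _
  | step x y hxy _ hA ih =>
    obtain ⟨δ, hxy⟩ := hxy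
    obtain ⟨t, ht⟩ := exists_factor_deflation hxy f (ih _)
    rw [← ht, hW _ hA t, comp_zero]

theorem exists_ne_zero_of_filt {M : C} (hM : 𝔼.Filt Y M) (hM₀ : ¬ IsZero M) :
    ∃ (A : C) (f : A ⟶ M), Y A ∧ f ≠ 0 := by
  by_contra! h
  exact hM₀ ((IsZero.iff_id_eq_zero M).2 (eq_zero_of_filt (fun A hA f => h A f hA) hM _))

/-- A nonzero morphism from a member of a semibrick to a filtered object is an inflation, and its
cone has a shorter filtration. -/
theorem exists_conflation_of_ne_zero (hX : IsSemibrick X) (hY : Y.IsClosedUnderIsomorphisms)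
    (hYX : Y ≤ X) {n : ℕ} {M : C} (hM : 𝔼.FiltN Y n M) {S : C} (hS : X S) {f : S ⟶ M}
    (hf : f ≠ 0) :
    Y S ∧ ∃ (m : ℕ) (Q : C) (g : M ⟶ Q), n = m + 1 ∧ 𝔼.Conflation f g ∧ 𝔼.FiltN Y m Q := by
  induction hM with
  | zero M hM => exact absurd (hM.eq_of_tgt _ _) hf
  | @step n A M N i p hip hA hN ih =>
    by_cases hfp : f ≫ p = 0
    -- Here `f` lands in the bottom factor, so by Schur's lemma it is `i` up to an isomorphism of
    -- the sources.
    · obtain ⟨δ, hδ⟩ := id hip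
      obtain ⟨s, rfl⟩ := exists_factor_inflation hδ f hfp
      have : IsIso s := hX.isIso_of_ne_zero hS (hYX _ hA)
        (fun h => hf (by rw [h, zero_comp]))
      exact ⟨Y.prop_of_iso (asIso s).symm hA, n, N, p, rfl, conflation_of_iso_left hip (asIso s), hN⟩
    · obtain ⟨hYS, m, N', q, rfl, ⟨δ', hq⟩, hN'⟩ := ih hfp
      obtain ⟨δ, hip⟩ := hip
      -- By induction `f ≫ p` is an inflation. `H` is the preimage of `S` in `M`, an extension of
      -- `S` by `A`, and `f` factors through it as `t`.
      obtain ⟨H, h', d, e, δ'', h₁, h₂, h₃, h₄, -⟩ := 𝔼.et4_op hip hq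
      obtain ⟨t, ht⟩ := exists_factor_inflation h₃ f
        (by rw [← Category.assoc, comp_eq_zero hq])
      have hte : t ≫ e ≠ 0 := fun h => hfp (by rw [← ht, Category.assoc, h₁, reassoc_of% h, zero_comp])
      -- By Schur's lemma `t` splits `e` up to an isomorphism, so `t` is the inclusion of a summand
      -- of `H` with complement `A`.
      have : IsIso (t ≫ e) := hX.isIso_of_ne_zero hS hS hte
      have hs : (inv (t ≫ e) ≫ t) ≫ e = 𝟙 S := by simp
      obtain ⟨r, hr₁, hr₂, hr₃⟩ := conflation_of_section ⟨_, h₄⟩ _ hs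
      have htr : t ≫ r = 0 := by simpa using hr₂
      obtain ⟨δ₁, hδ₁⟩ : 𝔼.Conflation t r := conflation_of_total (r := e ≫ inv (t ≫ e)) (s := d)
        (by rw [← Category.assoc]; simp) hr₁ htr (by rw [reassoc_of% (comp_eq_zero h₄), zero_comp])
        (by rw [add_comm, Category.assoc]; exact hr₃)
      -- Dividing `M` by `S` leaves an extension of `N'` by the complement `A`, so only one factor
      -- has been lost.
      obtain ⟨Q, g, a, b, δ₂, -, -, h₅, h₆, -⟩ := 𝔼.et4 hδ₁ h₃
      rw [ht] at h₅
      exact ⟨hYS, m + 1, Q, g, rfl, ⟨_, h₅⟩, .step a b ⟨_, h₆⟩ hA hN'⟩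

theorem filtN_cone_of_ne_zero (hX : IsSemibrick X) (hY : Y.IsClosedUnderIsomorphisms)
    (hYX : Y ≤ X) {n : ℕ} {M : C} (hM : 𝔼.FiltN Y n M) {S : C} (hS : X S) {f : S ⟶ M}
    (hf : f ≠ 0) {Q : C} {g : M ⟶ Q} (hfg : 𝔼.Conflation f g) :
    ∃ m, n = m + 1 ∧ 𝔼.FiltN Y m Q := by
  obtain ⟨-, m, Q', g', hn, h, hQ'⟩ := exists_conflation_of_ne_zero hX hY hYX hM hS hf
  obtain ⟨e⟩ := nonempty_cone_iso h hfg
  exact ⟨m, hn, hQ'.of_iso e⟩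

/-- `Filt(Y)` is closed under those retracts that lie in `Filt(X)`. -/
theorem filt_of_retract (hX : IsSemibrick X) (hY : Y.IsClosedUnderIsomorphisms) (hYX : Y ≤ X)
    {A M : C} (hA : 𝔼.Filt X A) (hM : 𝔼.Filt Y M) (ρ : Retract A M) : 𝔼.Filt Y A := by
  obtain ⟨n, hn⟩ := filt_iff_exists_filtN.1 hM
  clear hM
  induction n generalizing A M with
  | zero =>
    cases hn with
    | zero _ hM =>
      refine .zero A ((IsZero.iff_id_eq_zero A).2 ?_)
      rw [← ρ.retract, hM.eq_of_src ρ.r 0, comp_zero]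
  | succ n ih =>
    by_cases hA₀ : IsZero A
    · exact .zero A hA₀
    obtain ⟨B, a, hB, ha⟩ := exists_ne_zero_of_filt hA hA₀
    -- The brick `B` is known only to lie in `X`; the filtration of `M` forces it into `Y`. Dividing
    -- both `A` and `M` by `B` keeps the retract.
    have hai : a ≫ ρ.i ≠ 0 := fun h => ha (by simpa using h =≫ ρ.r)
    obtain ⟨hYB, m, Q, g, hm, hQ, hQ'⟩ := exists_conflation_of_ne_zero hX hY hYX hn hB hai
    obtain ⟨l, hl⟩ := filt_iff_exists_filtN.1 hA
    obtain ⟨-, l', P, p, -, hP, hP'⟩ :=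
      exists_conflation_of_ne_zero hX hX.closedUnderIso le_rfl hl hB ha
    obtain ⟨ρ'⟩ := exists_retract_cone hP hQ ρ.i ρ.r ρ.retract rfl (by simp)
    obtain rfl : n = m := by omega
    exact 𝔼.filt_extensionClosed Y _ _ hP (filt_of_mem hYB) (ih hP'.filt ρ' hQ')

theorem isClosedUnderSummands_filt (hX : IsSemibrick X) (hT : ∀ M, 𝔼.Filt X M)
    (hY : Y.IsClosedUnderIsomorphisms) (hYX : Y ≤ X) : IsClosedUnderSummands (𝔼.Filt Y) where
  closedUnderIso := ⟨fun e h => 𝔼.filt_of_iso Y e h⟩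
  summand b _ h :=
    ⟨filt_of_retract hX hY hYX (hT _) h ⟨b.inl, b.fst, b.inl_fst⟩,
      filt_of_retract hX hY hYX (hT _) h ⟨b.inr, b.snd, b.inr_snd⟩⟩

/-- Every filtered object is an extension of an object of `Y^⊥` by an object of `Filt(Y)`. -/
theorem exists_conflation_filt_rightPerp (hX : IsSemibrick X) (hYX : Y ≤ X) {M : C}
    (hM : 𝔼.Filt X M) :
    ∃ (N P : C) (x : N ⟶ M) (p : M ⟶ P), 𝔼.Conflation x p ∧ 𝔼.Filt Y N ∧ rightPerp Y P := by
  obtain ⟨n, hn⟩ := filt_iff_exists_filtN.1 hM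
  clear hM
  induction n generalizing M with
  | zero =>
    cases hn with
    | zero _ hM =>
      exact ⟨M, M, 𝟙 M, 0, 𝔼.conflation_id_left M hM, .zero M hM, fun A _ f => hM.eq_of_tgt _ _⟩
  | succ n ih =>
    by_cases h : rightPerp Y M
    · obtain ⟨O, hO⟩ := exists_isZero C
      exact ⟨O, M, 0, 𝟙 M, ⟨_, 𝔼.realizes_id_right M hO⟩, .zero O hO, h⟩
    · simp only [rightPerp, not_forall] at h
      obtain ⟨A, hA, f, hf⟩ := h
      obtain ⟨-, m, Q, g, hm, ⟨δ, hQ⟩, hQ'⟩ :=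
        exists_conflation_of_ne_zero hX hX.closedUnderIso le_rfl hn (hYX _ hA) hf
      obtain rfl : n = m := by omega
      obtain ⟨N, P, x, p, ⟨δ', hx⟩, hN, hP⟩ := ih hQ'
      -- `H` is the preimage of `N ⟶ Q` in `M`, an extension of `N` by `A`; the quotient `P` is
      -- unchanged.
      obtain ⟨H, h', d, e, δ'', -, -, h₃, h₄, -⟩ := 𝔼.et4_op hQ hx
      exact ⟨H, P, h', g ≫ p, ⟨_, h₃⟩,
        𝔼.filt_extensionClosed Y _ _ ⟨_, h₄⟩ (filt_of_mem hA) hN, hP⟩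

theorem isContravariantlyFinite_filt (hX : IsSemibrick X) (hT : ∀ M, 𝔼.Filt X M) (hYX : Y ≤ X) :
    IsContravariantlyFinite (𝔼.Filt Y) := by
  intro M
  obtain ⟨N, P, x, p, ⟨δ, h⟩, hN, hP⟩ := exists_conflation_filt_rightPerp hX hYX (hT M)
  exact ⟨N, x, hN, fun A hA g => exists_factor_inflation h g (eq_zero_of_filt hP hA _)⟩

/-! ### Supports -/

/-- A brick with a nonzero morphism to `M` lies in every `Y` with `F Y`, and its cone, which does
not depend on `Y`, is again filtered by each of them. Induction on the length then applies to the
cone. -/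
theorem filt_iInf (hX : IsSemibrick X) (F : ObjectProperty C → Prop)
    (hF : ∀ Y, F Y → Y.IsClosedUnderIsomorphisms ∧ Y ≤ X) {M : C} (hM : 𝔼.Filt X M)
    (h : ∀ Y, F Y → 𝔼.Filt Y M) : 𝔼.Filt (fun A => X A ∧ ∀ Y, F Y → Y A) M := by
  obtain ⟨n, hn⟩ := filt_iff_exists_filtN.1 hM
  induction n generalizing M with
  | zero =>
    cases hn with
    | zero _ hM => exact .zero M hM
  | succ n ih =>
    by_cases hM₀ : IsZero M
    · exact .zero M hM₀
    obtain ⟨B, f, hB, hf⟩ := exists_ne_zero_of_filt hM hM₀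
    obtain ⟨-, m, Q, g, hm, hQ, hQ'⟩ :=
      exists_conflation_of_ne_zero hX hX.closedUnderIso le_rfl hn hB hf
    obtain rfl : n = m := by omega
    have key : ∀ Y, F Y → Y B ∧ 𝔼.Filt Y Q := by
      intro Y hY
      obtain ⟨l, hl⟩ := filt_iff_exists_filtN.1 (h Y hY)
      obtain ⟨hl', -⟩ := exists_conflation_of_ne_zero hX (hF Y hY).1 (hF Y hY).2 hl hB hf
      obtain ⟨m', -, hm'⟩ := filtN_cone_of_ne_zero hX (hF Y hY).1 (hF Y hY).2 hl hB hf hQ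
      exact ⟨hl', hm'.filt⟩
    exact 𝔼.filt_extensionClosed _ _ _ hQ (filt_of_mem ⟨hB, fun Y hY => (key Y hY).1⟩)
      (ih hQ'.filt (fun Y hY => (key Y hY).2) hQ')

/-- A brick isomorphic to no member of `Y'` receives only zero morphisms from `Filt(Y')`; if it lay
there, its identity would vanish. -/
theorem le_of_filt_le (hX : IsSemibrick X) {Y' : ObjectProperty C}
    (hY : Y ≤ X) (hY'i : Y'.IsClosedUnderIsomorphisms) (hY' : Y' ≤ X)
    (h : 𝔼.Filt Y ≤ 𝔼.Filt Y') : Y ≤ Y' := by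
  intro A hA
  by_contra hA'
  refine hX.id_ne_zero (hY _ hA) (eq_zero_of_filt ?_ (h _ (filt_of_mem hA)) (𝟙 A))
  exact fun B hB f => hX.orthogonal B A (hY' _ hB) (hY _ hA)
    (fun ⟨e⟩ => hA' (Y'.prop_of_iso e hB)) f

theorem existsUnique_isSupport (hX : IsSemibrick X) (hT : ∀ M, 𝔼.Filt X M)
    (D : ObjectProperty C) : ∃! Y, 𝔼.IsSupport X D Y := by
  let F : ObjectProperty C → Prop := fun Y => Y.IsClosedUnderIsomorphisms ∧ Y ≤ X ∧ D ≤ 𝔼.Filt Y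
  refine existsUnique_of_exists_of_unique ⟨fun A => X A ∧ ∀ Y, F Y → Y A, ?_⟩ ?_
  · refine ⟨⟨fun e h => ⟨hX.closedUnderIso.of_iso e h.1,
      fun Y hY => hY.1.of_iso e (h.2 Y hY)⟩⟩, fun A h => h.1, fun M hM => ?_, ?_⟩
    · exact filt_iInf hX F (fun Y hY => ⟨hY.1, hY.2.1⟩) (hT M) (fun Y hY => hY.2.2 M hM)
    · exact fun Y h₁ h₂ h₃ => filt_mono fun A hA => hA.2 Y ⟨h₁, h₂, h₃⟩
  · intro Y Y' h h'
    exact le_antisymm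
      (le_of_filt_le hX h.le h'.closedUnderIso h'.le
        (h.minimal Y' h'.closedUnderIso h'.le h'.le_filt))
      (le_of_filt_le hX h'.le h.closedUnderIso h.le
        (h'.minimal Y h.closedUnderIso h.le h.le_filt))

end Extriangulated

/-! ### Cotorsion pairs from approximations of minimal length -/

namespace Extriangulated

variable {C : Type u} [Category.{v} C] [Preadditive C] [HasFiniteBiproducts C]
variable {𝔼 : Extriangulated.{w} C}

/-! ### Exactness of `E` in the middle -/

/-- Realize `ε` by `V ⟶ W ⟶ B`. The deflation `W ⟶ Z` has a cocone that extends `A` by `V` along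
`pull x ε`. When this splits, pushing the extension of `W ⟶ Z` along a retraction onto `V` gives
`ε'`. -/
theorem exists_pull_of_pull_eq_zero {A B Z : C} {δ : 𝔼.Ext Z A} {x : A ⟶ B} {y : B ⟶ Z}
    (h : 𝔼.Realizes δ x y) {V : C} (ε : 𝔼.Ext B V) (hε : 𝔼.pull x ε = 0) :
    ∃ ε' : 𝔼.Ext Z V, 𝔼.pull y ε' = ε := by
  obtain ⟨W, i, p, hW⟩ := 𝔼.exists_realizes ε
  obtain ⟨H, h', d, e, δ'', -, -, -, h₁, -, h₂⟩ := 𝔼.et4_op hW h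
  obtain ⟨r, hr⟩ := exists_extend h₁ (𝟙 V) (by rw [hε, ExtData.push_zero])
  exact ⟨𝔼.push r δ'', by
    rw [← ExtData.push_pull, ← h₂, ← ExtData.push_comp, hr, ExtData.push_id]⟩

theorem exists_push_of_push_eq_zero {A B Z : C} {δ : 𝔼.Ext Z A} {x : A ⟶ B} {y : B ⟶ Z}
    (h : 𝔼.Realizes δ x y) {V : C} (ε : 𝔼.Ext V B) (hε : 𝔼.push y ε = 0) :
    ∃ ε' : 𝔼.Ext V A, 𝔼.push x ε' = ε := by
  obtain ⟨W, i, p, hW⟩ := 𝔼.exists_realizes ε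
  obtain ⟨H, h', d, e, δ'', -, -, -, h₁, -, h₂⟩ := 𝔼.et4 h hW
  obtain ⟨s, hs⟩ := exists_lift h₁ (𝟙 V) (by rw [hε, ExtData.pull_zero])
  exact ⟨𝔼.pull s δ'', by
    rw [ExtData.push_pull, h₂, ← ExtData.pull_comp, hs, ExtData.pull_id]⟩

theorem exists_pull_of_push_eq_zero {A B Z : C} {δ : 𝔼.Ext Z A} {x : A ⟶ B} {y : B ⟶ Z}
    (h : 𝔼.Realizes δ x y) {V : C} (ε : 𝔼.Ext V A) (hε : 𝔼.push x ε = 0) :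
    ∃ c : V ⟶ Z, 𝔼.pull c δ = ε := by
  obtain ⟨W, i, p, hW⟩ := 𝔼.exists_realizes ε
  obtain ⟨s, hs⟩ := exists_extend hW x hε
  obtain ⟨c, -, hc⟩ := 𝔼.et3 (𝟙 A) s hW h (by simp [hs])
  exact ⟨c, by rw [← hc, ExtData.push_id]⟩

/-! ### Orthogonal complements with respect to `E` -/

variable {X Y : ObjectProperty C}

theorem ext_eq_zero_of_filt {V : C} (hV : 𝔼.rightPerpOne Y V) {M : C} (hM : 𝔼.Filt Y M)
    (ε : 𝔼.Ext M V) : ε = 0 := by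
  induction hM with
  | zero M hM => exact 𝔼.ext_eq_zero_of_isZero_left hM ε
  | step f g hfg _ hA ih =>
    obtain ⟨δ, hfg⟩ := hfg
    obtain ⟨ε', rfl⟩ := exists_pull_of_pull_eq_zero hfg ε (ih _)
    rw [hV _ hA ε', ExtData.pull_zero]

theorem rightPerpOne_extensionClosed : 𝔼.IsExtensionClosed (𝔼.rightPerpOne Y) := by
  rintro A B Z x y ⟨δ, h⟩ hA hZ S hS ε
  obtain ⟨ε', rfl⟩ := exists_push_of_push_eq_zero h ε (hZ S hS _)
  rw [hA S hS ε', ExtData.push_zero]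

theorem rightPerpOne_of_retract {V W : C} (hW : 𝔼.rightPerpOne Y W) (ρ : Retract V W) :
    𝔼.rightPerpOne Y V := by
  intro S hS ε
  rw [← 𝔼.push_id ε, ← ρ.retract, ExtData.push_comp, hW S hS (𝔼.push ρ.i ε), ExtData.push_zero]

theorem isClosedUnderSummands_rightPerpOne : IsClosedUnderSummands (𝔼.rightPerpOne Y) where
  closedUnderIso := ⟨fun e h => rightPerpOne_of_retract h ⟨e.inv, e.hom, e.inv_hom_id⟩⟩
  summand b _ h := ⟨rightPerpOne_of_retract h ⟨b.inl, b.fst, b.inl_fst⟩,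
    rightPerpOne_of_retract h ⟨b.inr, b.snd, b.inr_snd⟩⟩

theorem rightPerpOne_of_injective {I : C} (hI : 𝔼.injectives I) : 𝔼.rightPerpOne Y I := by
  intro S _ ε
  obtain ⟨W, i, p, hW⟩ := 𝔼.exists_realizes ε
  obtain ⟨r, hr⟩ := hI i p ⟨_, hW⟩ (𝟙 I)
  rw [← 𝔼.push_id ε, ← hr, ExtData.push_comp, push_eq_zero hW, ExtData.push_zero]

/-! ### Pullbacks of deflations -/

/-- The morphism `(c, y)` is the deflation `1 ⊕ y` followed by the split deflation `(c, 1)`, and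
(ET4)ᵒᵖ composes them. The cocone `H` is a weak pullback of `y` along `c`. -/
theorem exists_conflation_desc [HasBinaryBiproducts C] {A B Z : C} {x : A ⟶ B} {y : B ⟶ Z}
    (h : 𝔼.Conflation x y) {B' : C} (c : B' ⟶ Z) :
    ∃ (H : C) (u : H ⟶ B' ⊞ B) (d : A ⟶ H) (e : H ⟶ B'),
      𝔼.Conflation u (biprod.desc c y) ∧ 𝔼.Conflation d e := by
  obtain ⟨O, hO⟩ := exists_isZero C
  obtain ⟨δ, h⟩ := h
  let b : BinaryBicone O A :=
    { pt := A, fst := 0, snd := 𝟙 A, inl := 0, inr := 𝟙 A, inl_fst := hO.eq_of_src _ _ }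
  have h₁ := 𝔼.realizes_sum (𝔼.realizes_id_right B' hO) h b (BinaryBiproduct.bicone B' B)
    (BinaryBiproduct.bicone B' Z) (isBinaryBilimitOfTotal b (by simp [b]))
    (BinaryBiproduct.isBilimit B' B) (BinaryBiproduct.isBilimit B' Z)
  obtain ⟨δ', h₂⟩ : 𝔼.Conflation (biprod.lift (𝟙 B') (-c)) (biprod.desc c (𝟙 Z)) :=
    conflation_of_total (r := biprod.fst) (s := biprod.inr) (by simp) (by simp) (by simp)
      (by simp) (by ext <;> simp)
  obtain ⟨H, u, d, e, δ'', -, -, h₃, h₄, -⟩ := 𝔼.et4_op h₁ h₂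
  refine ⟨H, u, d, e, ⟨δ'', ?_⟩, _, h₄⟩
  convert h₃ using 1
  ext <;> simp

/-! ### Approximations of minimal length -/

/-- A morphism of objects of `Filt(Y)` that is injective on the socle and does not increase the
length is an isomorphism. -/
theorem isIso_of_injective_on_socle (hX : IsSemibrick X) (hY : Y.IsClosedUnderIsomorphisms)
    (hYX : Y ≤ X) {n : ℕ} {U W : C} (hW : 𝔼.FiltN Y n W) (hU : 𝔼.Filt Y U)
    (hn : ∀ m < n, ¬ 𝔼.FiltN Y m U) (e : U ⟶ W)
    (he : ∀ A, Y A → ∀ a : A ⟶ U, a ≫ e = 0 → a = 0) : IsIso e := by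
  induction n generalizing U W with
  | zero =>
    cases hW with
    | zero _ hW =>
      have hU₀ : IsZero U := by
        by_contra hU₀
        obtain ⟨A, a, hA, ha⟩ := exists_ne_zero_of_filt hU hU₀
        exact ha (he A hA a (hW.eq_of_tgt _ _))
      exact ⟨0, hU₀.eq_of_src _ _, hW.eq_of_src _ _⟩
  | succ n ih =>
    obtain ⟨A, a, hA, ha⟩ := exists_ne_zero_of_filt hU
      (fun hU₀ => hn 0 (Nat.succ_pos n) (.zero U hU₀))
    obtain ⟨l, hl⟩ := filt_iff_exists_filtN.1 hU
    obtain ⟨-, l', U', p, -, ⟨δ, hp⟩, hU'⟩ :=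
      exists_conflation_of_ne_zero hX hY hYX hl (hYX _ hA) ha
    obtain ⟨-, m, W', q, hm, ⟨δ', hq⟩, hW'⟩ :=
      exists_conflation_of_ne_zero hX hY hYX hW (hYX _ hA) (fun h => ha (he A hA a h))
    obtain rfl : n = m := by omega
    obtain ⟨c, hc, hc'⟩ := 𝔼.et3 (𝟙 A) e hp hq (by simp)
    have : IsIso c := by
      refine ih hW' hU'.filt (fun k hk hk' => hn (k + 1) (by omega) (.step a p ⟨_, hp⟩ hA hk')) c ?_
      -- Injectivity on the socle passes to `U'`: a `b` killed by `c` lifts to `b'` with `b' ≫ e`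
      -- landing in `A`; subtracting a morphism through `a` gives one killed by `e`, so `b'` factors
      -- through `a` and `b` is zero.
      intro B hB b hb
      rw [ExtData.push_id] at hc'
      obtain ⟨b', rfl⟩ := exists_lift hp b (by
        rw [hc', ← ExtData.pull_comp, hb, zero_pull])
      obtain ⟨s, hs⟩ := exists_factor_inflation hq (b' ≫ e) (by
        rw [Category.assoc, ← hc, ← Category.assoc, hb])
      have : b' = s ≫ a := by
        rw [← sub_eq_zero]
        exact he B hB _ (by simp [hs])
      rw [this, Category.assoc, comp_eq_zero hp, comp_zero]
    exact isIso_middle hp hq (𝟙 A) e c (by simp) hc hc'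

/-- Adding a deflation from a projective to a `Filt(Y)`-approximation makes it a deflation, and the
source stays in `Filt(Y)` because the projectives lie there. -/
theorem exists_conflation_approximation (hX : IsSemibrick X) (hT : ∀ M, 𝔼.Filt X M)
    (hYX : Y ≤ X) (hP : 𝔼.EnoughProjectives) (hPY : 𝔼.projectives ≤ 𝔼.Filt Y) (M : C) :
    ∃ (K U : C) (x : K ⟶ U) (y : U ⟶ M), 𝔼.Filt Y U ∧ 𝔼.Conflation x y ∧
      ∀ A, 𝔼.Filt Y A → ∀ g : A ⟶ M, ∃ h : A ⟶ U, h ≫ y = g := by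
  have := hasBinaryBiproducts_of_finite_biproducts C
  obtain ⟨N, f, hN, hf⟩ := isContravariantlyFinite_filt hX hT hYX M
  obtain ⟨L, P, i, p, hPp, h⟩ := hP M
  obtain ⟨H, u, d, e, hu, -⟩ := exists_conflation_desc h f
  refine ⟨H, N ⊞ P, u, biprod.desc f p, ?_, hu, fun A hA g => ?_⟩
  · exact 𝔼.filt_extensionClosed Y biprod.inl biprod.snd
      ⟨0, 𝔼.realizes_zero _ (BinaryBiproduct.isBilimit N P)⟩ hN (hPY _ hPp)
  · obtain ⟨k, hk⟩ := hf A hA g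
    exact ⟨k ≫ biprod.inl, by simp [hk]⟩

/-- Wakamatsu's lemma for approximations of minimal length. -/
theorem exists_special_precover (hX : IsSemibrick X) (hT : ∀ M, 𝔼.Filt X M)
    (hY : Y.IsClosedUnderIsomorphisms) (hYX : Y ≤ X) (hP : 𝔼.EnoughProjectives)
    (hPY : 𝔼.projectives ≤ 𝔼.Filt Y) (M : C) :
    ∃ (V U : C) (x : V ⟶ U) (y : U ⟶ M), 𝔼.rightPerpOne Y V ∧ 𝔼.Filt Y U ∧ 𝔼.Conflation x y := by
  classical
  have hex : ∃ (n : ℕ) (K U : C) (x : K ⟶ U) (y : U ⟶ M), 𝔼.FiltN Y n U ∧ 𝔼.Conflation x y ∧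
      ∀ A, 𝔼.Filt Y A → ∀ g : A ⟶ M, ∃ h : A ⟶ U, h ≫ y = g := by
    obtain ⟨K, U, x, y, hU, h⟩ := exists_conflation_approximation hX hT hYX hP hPY M
    obtain ⟨n, hn⟩ := filt_iff_exists_filtN.1 hU
    exact ⟨n, K, U, x, y, hn, h⟩
  obtain ⟨K, U, x, y, hU, ⟨κ, hκ⟩, happ⟩ := Nat.find_spec hex
  have hmin : ∀ m < Nat.find hex, ¬ 𝔼.FiltN Y m U :=
    fun m hm h => Nat.find_min hex hm ⟨K, U, x, y, h, ⟨κ, hκ⟩, happ⟩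
  -- Otherwise `A` embeds in the cocone `K`, and dividing `U` by it yields a shorter approximation
  -- that is still a deflation.
  have hsoc : ∀ A, Y A → ∀ a : A ⟶ U, a ≫ y = 0 → a = 0 := by
    intro A hA a hay
    by_contra ha
    obtain ⟨t, rfl⟩ := exists_factor_inflation hκ a hay
    obtain ⟨l, hl⟩ := filt_iff_exists_filtN.1 (hT K)
    obtain ⟨-, l', K', q, -, ⟨δ, hq⟩, -⟩ := exists_conflation_of_ne_zero hX hX.closedUnderIso le_rfl
      hl (hYX _ hA) (f := t) (fun h => ha (by rw [h, zero_comp]))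
    obtain ⟨H, h', d, e, δ'', -, h₁, h₂, h₃, -⟩ := 𝔼.et4 hq hκ
    obtain ⟨m, hm, hH⟩ := filtN_cone_of_ne_zero hX hY hYX hU (hYX _ hA) ha ⟨_, h₂⟩
    refine Nat.find_min hex (m := m) (by omega) ⟨K', H, d, e, hH, ⟨_, h₃⟩, fun B hB g => ?_⟩
    obtain ⟨k, rfl⟩ := happ B hB g
    exact ⟨k ≫ h', by rw [Category.assoc, h₁]⟩
  refine ⟨K, U, x, y, fun A hA δ => ?_, hU.filt, κ, hκ⟩
  -- The pushed extension has middle term `W` in `Filt(Y)`. As `x ≫ y = 0`, `y` extends to `W`, and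
  -- the extension factors back through `y`; the resulting endomorphism of `U` over `M` is
  -- invertible, so `u` splits.
  have hδ : 𝔼.push x δ = 0 := by
    obtain ⟨W, u, p, hW⟩ := 𝔼.exists_realizes (𝔼.push x δ)
    obtain ⟨z, hz⟩ := exists_extend hW y (by
      rw [← ExtData.push_comp, comp_eq_zero hκ, zero_push])
    obtain ⟨k, hk⟩ := happ W (.step u p ⟨_, hW⟩ hU.filt hA) z
    have hey : (u ≫ k) ≫ y = y := by rw [Category.assoc, hk, hz]
    have : IsIso (u ≫ k) := isIso_of_injective_on_socle hX hY hYX hU hU.filt hmin _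
      fun B hB b hb => hsoc B hB b (by rw [← hey, ← Category.assoc, hb, zero_comp])
    have huk : u ≫ k ≫ inv (u ≫ k) = 𝟙 U := by rw [← Category.assoc]; simp
    rw [← 𝔼.push_id (𝔼.push x δ), ← huk, ExtData.push_comp, push_eq_zero hW, ExtData.push_zero]
  -- Thus `δ` is pulled back from `κ` along some `c : A ⟶ M`. The approximation property lifts `c`
  -- through `y`, which kills it.
  obtain ⟨c, rfl⟩ := exists_pull_of_push_eq_zero hκ δ hδ
  obtain ⟨k, rfl⟩ := happ A (filt_of_mem hA) c
  rw [ExtData.pull_comp, pull_eq_zero hκ, ExtData.pull_zero]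

theorem isCotorsionPair_filt_rightPerpOne (hX : IsSemibrick X) (hT : ∀ M, 𝔼.Filt X M)
    (hY : Y.IsClosedUnderIsomorphisms) (hYX : Y ≤ X) (hP : 𝔼.EnoughProjectives)
    (hI : 𝔼.EnoughInjectives) (hPY : 𝔼.projectives ≤ 𝔼.Filt Y) :
    𝔼.IsCotorsionPair (𝔼.Filt Y) (𝔼.rightPerpOne Y) where
  summands_left := isClosedUnderSummands_filt hX hT hY hYX
  summands_right := isClosedUnderSummands_rightPerpOne
  ext_eq_zero _ _ hA hB := ext_eq_zero_of_filt hB hA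
  resolution := exists_special_precover hX hT hY hYX hP hPY
  coresolution M := by
    have := hasBinaryBiproducts_of_finite_biproducts C
    obtain ⟨I, Z, i, p, hI, hi⟩ := hI M
    obtain ⟨V, U, x, y, hV, hU, hx⟩ := exists_special_precover hX hT hY hYX hP hPY Z
    -- Salce's argument: one weak pullback of `I ⟶ Z ⟵ U`, read in two ways. `H` is an extension of
    -- `I` by `V`, hence in `Y^{⊥₁}`; `H'` is an extension of `U` by `M`. That `H'` is a retract of
    -- `H` suffices.
    obtain ⟨H, u, d, e, hu, hd⟩ := exists_conflation_desc hx p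
    obtain ⟨H', u', d', e', hu', hd'⟩ := exists_conflation_desc hi y
    have hH := rightPerpOne_extensionClosed _ _ hd hV (rightPerpOne_of_injective hI)
    obtain ⟨ρ⟩ := exists_retract_cocone hu' hu (biprod.braiding U I).hom (biprod.braiding U I).inv
      (Iso.hom_inv_id _) (by ext <;> simp) (by ext <;> simp)
    exact ⟨H', U, d', e', rightPerpOne_of_retract hH ρ, hU, hd'⟩

end Extriangulated

/-! ### Duality -/

namespace Extriangulated

theorem hasFiniteBiproducts_op {C : Type u} [Category.{v} C] [Preadditive C]
    [HasFiniteBiproducts C] : HasFiniteBiproducts Cᵒᵖ := by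
  have : HasFiniteProducts Cᵒᵖ := hasFiniteProducts_opposite
  exact HasFiniteBiproducts.of_hasFiniteProducts

/-- The bicone in `C` given by a bicone in the opposite category. -/
def unopBicone {C : Type u} [Category.{v} C] [HasZeroMorphisms C] {A Z : Cᵒᵖ}
    (b : BinaryBicone A Z) : BinaryBicone Z.unop A.unop where
  pt := b.pt.unop
  fst := b.inr.unop
  snd := b.inl.unop
  inl := b.snd.unop
  inr := b.fst.unop
  inl_fst := congrArg Quiver.Hom.unop b.inr_snd
  inl_snd := congrArg Quiver.Hom.unop b.inl_snd
  inr_fst := congrArg Quiver.Hom.unop b.inr_fst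
  inr_snd := congrArg Quiver.Hom.unop b.inl_fst

/-- The previous bicone with its two summands exchanged. -/
def unopBiconeFlip {C : Type u} [Category.{v} C] [HasZeroMorphisms C] {A Z : Cᵒᵖ}
    (b : BinaryBicone A Z) : BinaryBicone A.unop Z.unop where
  pt := b.pt.unop
  fst := b.inl.unop
  snd := b.inr.unop
  inl := b.fst.unop
  inr := b.snd.unop
  inl_fst := congrArg Quiver.Hom.unop b.inl_fst
  inl_snd := congrArg Quiver.Hom.unop b.inr_fst
  inr_fst := congrArg Quiver.Hom.unop b.inl_snd
  inr_snd := congrArg Quiver.Hom.unop b.inr_snd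

theorem unop_total {C : Type u} [Category.{v} C] [Preadditive C] {A Z : Cᵒᵖ}
    {b : BinaryBicone A Z} (hb : b.IsBilimit) :
    b.inl.unop ≫ b.fst.unop + b.inr.unop ≫ b.snd.unop = 𝟙 b.pt.unop :=
  congrArg Quiver.Hom.unop (IsBilimit.binary_total hb)

variable {C : Type u} [Category.{v} C] [Preadditive C] [HasFiniteBiproducts C]

/-- The opposite of an extriangulated category. -/
def opposite (𝔼 : Extriangulated.{w} C) [HasFiniteBiproducts Cᵒᵖ] :
    Extriangulated.{w} Cᵒᵖ where
  E := unopUnop C ⋙ 𝔼.E.flip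
  Realizes {A B Z} δ x y := 𝔼.Realizes (A := Z.unop) (B := B.unop) (Z := A.unop) δ y.unop x.unop
  additive_fst := by
    refine ⟨fun {Z Z' f g} => ?_⟩
    ext A : 2
    have := 𝔼.additive_snd A
    exact Functor.map_add (𝔼.E.obj A)
  additive_snd Z := by
    refine ⟨fun {A A' f g} => ?_⟩
    have := 𝔼.additive_fst
    exact congrArg (fun t => t.app Z.unop.unop) (Functor.map_add 𝔼.E (f := f) (g := g))
  exists_realizes {A Z} δ := by
    obtain ⟨B, x, y, h⟩ := 𝔼.exists_realizes (A := Z.unop) (Z := A.unop) δ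
    exact ⟨op B, y.op, x.op, h⟩
  realizes_iff {A B B' Z δ x y} h x' y' := by
    refine (𝔼.realizes_iff (A := Z.unop) (Z := A.unop) h y'.unop x'.unop).trans ⟨?_, ?_⟩
    · rintro ⟨b, h₁, h₂⟩
      exact ⟨b.op.symm, Quiver.Hom.unop_inj ((Iso.inv_comp_eq b).2 h₂.symm),
        Quiver.Hom.unop_inj ((Iso.comp_inv_eq b).2 h₁.symm)⟩
    · rintro ⟨b, h₁, h₂⟩
      exact ⟨b.unop.symm, (Iso.comp_inv_eq b.unop).2 (congrArg Quiver.Hom.unop h₂).symm,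
        (Iso.inv_comp_eq b.unop).2 (congrArg Quiver.Hom.unop h₁).symm⟩
  realize_hom {A B Z A' B' Z' δ δ' x y x' y'} a c h h' hac := by
    obtain ⟨b, h₁, h₂⟩ := 𝔼.realize_hom (A := Z'.unop) (Z := A'.unop) (A' := Z.unop)
      (Z' := A.unop) c.unop a.unop h' h hac.symm
    exact ⟨b.op, Quiver.Hom.unop_inj h₂.symm, Quiver.Hom.unop_inj h₁.symm⟩
  realizes_zero {A Z} b hb :=
    𝔼.realizes_zero (unopBicone b) (isBinaryBilimitOfTotal _ ((add_comm _ _).trans (unop_total hb)))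
  realizes_sum {A B Z A' B' Z' δ δ' x y x' y'} h h' bA bB bZ hA hB hZ := by
    have key := 𝔼.realizes_sum (A := Z.unop) (B := B.unop) (Z := A.unop) (A' := Z'.unop)
      (B' := B'.unop) (Z' := A'.unop) h h' (unopBiconeFlip bZ) (unopBiconeFlip bB)
      (unopBiconeFlip bA) (isBinaryBilimitOfTotal _ (unop_total hZ))
      (isBinaryBilimitOfTotal _ (unop_total hB)) (isBinaryBilimitOfTotal _ (unop_total hA))
    -- Duality exchanges `push` and `pull`, so the two actions occur in the opposite order and must
    -- be commuted.
    rw [ExtData.push_pull, ExtData.push_pull] at key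
    simp only [← Category.assoc] at key
    exact key
  et3 {A B Z A' B' Z' δ δ' x y x' y'} a b h h' hab := by
    obtain ⟨c, h₁, h₂⟩ := 𝔼.et3_op (A := Z'.unop) (Z := A'.unop) (A' := Z.unop)
      (Z' := A.unop) b.unop a.unop h' h (congrArg Quiver.Hom.unop hab).symm
    exact ⟨c.op, Quiver.Hom.unop_inj h₁.symm, h₂.symm⟩
  et3_op {A B Z A' B' Z' δ δ' x y x' y'} b c h h' hbc := by
    obtain ⟨a, h₁, h₂⟩ := 𝔼.et3 (A := Z'.unop) (Z := A'.unop) (A' := Z.unop)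
      (Z' := A.unop) c.unop b.unop h' h (congrArg Quiver.Hom.unop hbc).symm
    exact ⟨a.op, Quiver.Hom.unop_inj h₁.symm, h₂.symm⟩
  et4 {A B K G F δ δ' f f' g g'} h h' := by
    obtain ⟨H, k, d, e, δ'', h₁, h₂, h₃, h₄, h₅, h₆⟩ :=
      𝔼.et4_op (D := F.unop) (A := G.unop) (B := B.unop) (F := K.unop) (Z := A.unop) h' h
    exact ⟨op H, k.op, e.op, d.op, δ'', Quiver.Hom.unop_inj h₁.symm, Quiver.Hom.unop_inj h₂, h₃, h₄,
      h₅, h₆.symm⟩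
  et4_op {K A B F Z δ δ' f' f g' g} h h' := by
    obtain ⟨H, k, d, e, δ'', h₁, h₂, h₃, h₄, h₅, h₆⟩ :=
      𝔼.et4 (A := Z.unop) (B := B.unop) (D := F.unop) (G := A.unop) (F := K.unop) h' h
    exact ⟨op H, k.op, e.op, d.op, δ'', Quiver.Hom.unop_inj h₁.symm, Quiver.Hom.unop_inj h₂, h₃, h₄,
      h₅, h₆.symm⟩

section

variable {𝔼 : Extriangulated.{w} C} [HasFiniteBiproducts Cᵒᵖ] {X Y : ObjectProperty C}

/-- Passing to the opposite turns top factors into bottom factors; closure under extensions makes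
the two kinds of filtration interchangeable. -/
theorem opposite_filt_iff {M : Cᵒᵖ} : 𝔼.opposite.Filt X.op M ↔ 𝔼.Filt X M.unop := by
  constructor
  · intro h
    induction h with
    | zero M hM => exact .zero _ hM.unop
    | step f g hfg _ hA ih => exact 𝔼.filt_extensionClosed X g.unop f.unop hfg (filt_of_mem hA) ih
  · have key (M : C) (h : 𝔼.Filt X M) : 𝔼.opposite.Filt X.op (op M) := by
      induction h with
      | zero M hM => exact .zero _ hM.op
      | step f g hfg _ hA ih =>
        exact 𝔼.opposite.filt_extensionClosed X.op g.op f.op hfg (filt_of_mem hA) ih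
    exact key M.unop

theorem isSemibrick_op {C : Type u} [Category.{v} C] [Preadditive C] {X : ObjectProperty C}
    (hX : IsSemibrick X) : IsSemibrick X.op where
  closedUnderIso := ⟨fun e h => hX.closedUnderIso.of_iso e.unop.symm h⟩
  brick A hA := by
    have h := hX.brick A.unop hA
    refine ⟨⟨⟨𝟙 A, 0, fun h' => hX.id_ne_zero hA (congrArg Quiver.Hom.unop h')⟩⟩, fun f hf => ?_⟩
    have : IsIso f.unop :=
      hX.isIso_of_ne_zero hA hA (fun h' => hf (Quiver.Hom.unop_inj h'))
    exact (isUnit_iff_isIso f).2 ((isIso_unop_iff f).1 this)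
  orthogonal A B hA hB h f :=
    Quiver.Hom.unop_inj (hX.orthogonal B.unop A.unop hB hA (fun ⟨e⟩ => h ⟨e.op⟩) f.unop)

theorem isClosedUnderIsomorphisms_op {C : Type u} [Category.{v} C] {X : ObjectProperty C}
    (hX : X.IsClosedUnderIsomorphisms) : X.op.IsClosedUnderIsomorphisms :=
  ⟨fun e h => hX.of_iso e.unop.symm h⟩

theorem opposite_projectives_iff {M : Cᵒᵖ} :
    𝔼.opposite.projectives M ↔ 𝔼.injectives M.unop := by
  constructor
  · intro h A B Z x y hxy a
    obtain ⟨b, hb⟩ := h y.op x.op hxy a.op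
    exact ⟨b.unop, congrArg Quiver.Hom.unop hb⟩
  · intro h A B Z x y hxy a
    obtain ⟨b, hb⟩ := h y.unop x.unop hxy a.unop
    exact ⟨b.op, Quiver.Hom.unop_inj hb⟩

theorem opposite_injectives_iff {M : Cᵒᵖ} :
    𝔼.opposite.injectives M ↔ 𝔼.projectives M.unop := by
  constructor
  · intro h A B Z x y hxy a
    obtain ⟨b, hb⟩ := h y.op x.op hxy a.op
    exact ⟨b.unop, congrArg Quiver.Hom.unop hb⟩
  · intro h A B Z x y hxy a
    obtain ⟨b, hb⟩ := h y.unop x.unop hxy a.unop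
    exact ⟨b.op, Quiver.Hom.unop_inj hb⟩

theorem enoughProjectives_opposite (h : 𝔼.EnoughInjectives) :
    𝔼.opposite.EnoughProjectives := by
  intro M
  obtain ⟨I, A, x, y, hI, hxy⟩ := h M.unop
  exact ⟨op A, op I, y.op, x.op, opposite_projectives_iff.2 hI, hxy⟩

theorem enoughInjectives_opposite (h : 𝔼.EnoughProjectives) :
    𝔼.opposite.EnoughInjectives := by
  intro M
  obtain ⟨A, P, x, y, hP, hxy⟩ := h M.unop
  exact ⟨op P, op A, y.op, x.op, opposite_injectives_iff.2 hP, hxy⟩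

end

variable {𝔼 : Extriangulated.{w} C} {X Y : ObjectProperty C}

/-- Every filtered object is an extension of an object of `Filt(Y)` by an object of `^⊥Y`. -/
theorem exists_conflation_leftPerp_filt (hX : IsSemibrick X) (hYX : Y ≤ X) {M : C}
    (hM : 𝔼.Filt X M) :
    ∃ (U V : C) (q : U ⟶ M) (y : M ⟶ V), 𝔼.Conflation q y ∧ leftPerp Y U ∧ 𝔼.Filt Y V := by
  have := hasFiniteBiproducts_op (C := C)
  obtain ⟨N, P, x, p, h, hN, hP⟩ := exists_conflation_filt_rightPerp (𝔼 := 𝔼.opposite)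
    (X := X.op) (Y := Y.op) (M := op M) (isSemibrick_op hX) (fun A hA => hYX _ hA)
    (opposite_filt_iff.2 hM)
  exact ⟨P.unop, N.unop, p.unop, x.unop, h,
    fun A hA f => congrArg Quiver.Hom.unop (hP (op A) hA f.op), opposite_filt_iff.1 hN⟩

theorem isCovariantlyFinite_filt (hX : IsSemibrick X) (hT : ∀ M, 𝔼.Filt X M) (hYX : Y ≤ X) :
    IsCovariantlyFinite (𝔼.Filt Y) := by
  have := hasFiniteBiproducts_op (C := C)
  intro M
  obtain ⟨A, f, hA, hf⟩ := isContravariantlyFinite_filt (𝔼 := 𝔼.opposite) (X := X.op) (Y := Y.op)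
    (isSemibrick_op hX) (fun M => opposite_filt_iff.2 (hT M.unop)) (fun A hA => hYX _ hA) (op M)
  refine ⟨A.unop, f.unop, opposite_filt_iff.1 hA, fun B hB g => ?_⟩
  obtain ⟨h, hh⟩ := hf (op B) (opposite_filt_iff.2 hB) g.op
  exact ⟨h.unop, congrArg Quiver.Hom.unop hh⟩

theorem leftPerpOne_of_retract {V W : C} (hW : 𝔼.leftPerpOne Y W) (ρ : Retract V W) :
    𝔼.leftPerpOne Y V := by
  intro S hS ε
  rw [← 𝔼.pull_id ε, ← ρ.retract, ExtData.pull_comp, hW S hS (𝔼.pull ρ.r ε), ExtData.pull_zero]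

theorem isClosedUnderSummands_leftPerpOne : IsClosedUnderSummands (𝔼.leftPerpOne Y) where
  closedUnderIso := ⟨fun e h => leftPerpOne_of_retract h ⟨e.inv, e.hom, e.inv_hom_id⟩⟩
  summand b _ h := ⟨leftPerpOne_of_retract h ⟨b.inl, b.fst, b.inl_fst⟩,
    leftPerpOne_of_retract h ⟨b.inr, b.snd, b.inr_snd⟩⟩

theorem isCotorsionPair_leftPerpOne_filt (hX : IsSemibrick X) (hT : ∀ M, 𝔼.Filt X M)
    (hY : Y.IsClosedUnderIsomorphisms) (hYX : Y ≤ X) (hP : 𝔼.EnoughProjectives)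
    (hI : 𝔼.EnoughInjectives) (hIY : 𝔼.injectives ≤ 𝔼.Filt Y) :
    𝔼.IsCotorsionPair (𝔼.leftPerpOne Y) (𝔼.Filt Y) := by
  have := hasFiniteBiproducts_op (C := C)
  have h := isCotorsionPair_filt_rightPerpOne (𝔼 := 𝔼.opposite) (X := X.op) (Y := Y.op)
    (isSemibrick_op hX) (fun M => opposite_filt_iff.2 (hT M.unop)) (isClosedUnderIsomorphisms_op hY)
    (fun A hA => hYX _ hA) (enoughProjectives_opposite hI) (enoughInjectives_opposite hP)
    (fun M hM => opposite_filt_iff.2 (hIY _ (opposite_projectives_iff.1 hM)))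
  have hperp {A : Cᵒᵖ} (hA : 𝔼.opposite.rightPerpOne Y.op A) : 𝔼.leftPerpOne Y A.unop :=
    fun S hS δ => hA (op S) hS δ
  refine ⟨isClosedUnderSummands_leftPerpOne, isClosedUnderSummands_filt hX hT hY hYX, ?_, ?_, ?_⟩
  · exact fun A B hA hB δ => h.ext_eq_zero (op B) (op A) (opposite_filt_iff.2 hB)
      (fun S hS ε => hA S.unop hS ε) δ
  · intro M
    obtain ⟨B, A, x, y, hB, hA, hxy⟩ := h.coresolution (op M)
    exact ⟨A.unop, B.unop, y.unop, x.unop, opposite_filt_iff.1 hA, hperp hB, hxy⟩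
  · intro M
    obtain ⟨B, A, x, y, hB, hA, hxy⟩ := h.resolution (op M)
    exact ⟨A.unop, B.unop, y.unop, x.unop, opposite_filt_iff.1 hA, hperp hB, hxy⟩

/-! ### The category `Filt(X)` -/

theorem isSemibrick_inFilt (hX : IsSemibrick X) : IsSemibrick (𝔼.inFilt X X) where
  closedUnderIso := ⟨fun e h => hX.closedUnderIso.of_iso ((𝔼.Filt X).ι.mapIso e) h⟩
  brick A hA := by
    refine ⟨⟨⟨𝟙 A, 0, fun h' => hX.id_ne_zero hA (congrArg (fun f => f.hom) h')⟩⟩, fun f hf => ?_⟩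
    have : IsIso f.hom :=
      hX.isIso_of_ne_zero hA hA (fun h' => hf (ObjectProperty.hom_ext _ h'))
    have : IsIso ((𝔼.Filt X).ι.map f) := this
    exact (isUnit_iff_isIso f).2 (isIso_of_fully_faithful (𝔼.Filt X).ι f)
  orthogonal A B hA hB h f :=
    ObjectProperty.hom_ext _ (hX.orthogonal A.obj B.obj hA hB
      (fun ⟨e⟩ => h ⟨ObjectProperty.isoMk _ e⟩) f.hom)

/-- All terms of a filtration in `C` already lie in `Filt(X)`, so it is a filtration inside `T`.
This is the hypothesis under which the preceding results apply to `T` itself. -/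
theorem filtCat_filt (M : (𝔼.Filt X).FullSubcategory) :
    (𝔼.filtCat X).Filt (𝔼.inFilt X X) M := by
  obtain ⟨M, hM⟩ := M
  induction id hM with
  | zero M hM₀ =>
    refine .zero _ ((IsZero.iff_id_eq_zero _).2 (ObjectProperty.hom_ext _ (hM₀.eq_of_src _ _)))
  | @step N M A f g hfg hN hA ih =>
    exact .step (N := ⟨N, hN⟩) (M := ⟨M, hM⟩) (A := ⟨A, filt_of_mem hA⟩) (ObjectProperty.homMk f)
      (ObjectProperty.homMk g) hfg (ih hN) hA

end Extriangulated

theorem mainTheorem4 {k : Type*} [Field k] {C : Type u} [Category.{v} C] [Preadditive C]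
    [Linear k C] [HasFiniteBiproducts C] [EssentiallySmall.{v} C]
    (hfin : ∀ A B : C, Module.Finite k (A ⟶ B)) (hKS : IsKrullSchmidt C)
    (𝔼 : Extriangulated.{w} C) (X : ObjectProperty C) (hX : IsSemibrick X)
    (S : ObjectProperty C) (hS : S.IsClosedUnderIsomorphisms) (hSX : S ≤ X) :
    -- (1)
    (∀ M : (𝔼.Filt X).FullSubcategory, ∃ (N P : (𝔼.Filt X).FullSubcategory)
      (x : N ⟶ M) (p : M ⟶ P), (𝔼.filtCat X).Conflation x p ∧
        (𝔼.filtCat X).Filt (𝔼.inFilt X S) N ∧ rightPerp (𝔼.inFilt X S) P) ∧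
    -- (2)
    (∀ M : (𝔼.Filt X).FullSubcategory, ∃ (U V : (𝔼.Filt X).FullSubcategory)
      (q : U ⟶ M) (y : M ⟶ V), (𝔼.filtCat X).Conflation q y ∧
        leftPerp (𝔼.inFilt X S) U ∧ (𝔼.filtCat X).Filt (𝔼.inFilt X S) V) ∧
    -- (3)
    IsFunctoriallyFinite ((𝔼.filtCat X).Filt (𝔼.inFilt X S)) ∧
    -- (4), beginning with the fact that the subsets `S_P` and `S_I` of `X` are well defined
    (∃! SP, (𝔼.filtCat X).IsSupport (𝔼.inFilt X X) (𝔼.filtCat X).projectives SP) ∧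
    (∃! SI, (𝔼.filtCat X).IsSupport (𝔼.inFilt X X) (𝔼.filtCat X).injectives SI) ∧
    ((𝔼.filtCat X).EnoughProjectives → (𝔼.filtCat X).EnoughInjectives →
      (∀ SP, (𝔼.filtCat X).IsSupport (𝔼.inFilt X X) (𝔼.filtCat X).projectives SP →
        SP ≤ 𝔼.inFilt X S →
        (𝔼.filtCat X).IsCotorsionPair ((𝔼.filtCat X).Filt (𝔼.inFilt X S))
          ((𝔼.filtCat X).rightPerpOne (𝔼.inFilt X S))) ∧
      (∀ SI, (𝔼.filtCat X).IsSupport (𝔼.inFilt X X) (𝔼.filtCat X).injectives SI →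
        SI ≤ 𝔼.inFilt X S →
        (𝔼.filtCat X).IsCotorsionPair ((𝔼.filtCat X).leftPerpOne (𝔼.inFilt X S))
          ((𝔼.filtCat X).Filt (𝔼.inFilt X S)))) := by
  have hX' : IsSemibrick (𝔼.inFilt X X) := Extriangulated.isSemibrick_inFilt hX
  have hT := Extriangulated.filtCat_filt (𝔼 := 𝔼) (X := X)
  have hYX : 𝔼.inFilt X S ≤ 𝔼.inFilt X X := fun A hA => hSX _ hA
  have hY : (𝔼.inFilt X S).IsClosedUnderIsomorphisms :=
    ⟨fun e h => hS.of_iso ((𝔼.Filt X).ι.mapIso e) h⟩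
  exact ⟨fun M => Extriangulated.exists_conflation_filt_rightPerp hX' hYX (hT M),
    fun M => Extriangulated.exists_conflation_leftPerp_filt hX' hYX (hT M),
    ⟨Extriangulated.isContravariantlyFinite_filt hX' hT hYX,
      Extriangulated.isCovariantlyFinite_filt hX' hT hYX⟩,
    Extriangulated.existsUnique_isSupport hX' hT _, Extriangulated.existsUnique_isSupport hX' hT _,
    fun hP hI => ⟨fun SP h hle => Extriangulated.isCotorsionPair_filt_rightPerpOne hX' hT hY hYX hP hI
        fun M hM => Extriangulated.filt_mono hle _ (h.le_filt M hM),
      fun SI h hle => Extriangulated.isCotorsionPair_leftPerpOne_filt hX' hT hY hYX hP hI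
        fun M hM => Extriangulated.filt_mono hle _ (h.le_filt M hM)⟩⟩
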